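/- Let $G\rightrightarrows Q$ be a Lie groupoid with source $\alpha$, target $\beta$, identity section $\epsilon$, inversion $i$ and multiplication $m$, defined on $G_2=\{(g,h)\in G\times G:\beta(g)=\alpha(h)\}$ ($G$, $Q$ smooth finite-dimensional Hausdorff manifolds, $\alpha,\beta$ submersions). Let $AG$ be its Lie algebroid, with fibre $A_qG=T_{\epsilon(q)}\alpha^{-1}(q)$. For a smooth section $X$ of $AG$ let $\overleftarrow X(g)=T\ell_g\,(X(\beta(g)))$ and $\overrightarrow X(g)=-T(r_g\circ i)\,(X(\alpha(g)))$ be the associated left- and right-invariant vector fields. Let $$\mathcal P^\alpha G=\{(g,h,r)\in G^3:\alpha(g)=\alpha(h),\ \beta(h)=\alpha(r)\}\rightrightarrows G$$ be the prolongation of $G$ over $\alpha$, with source $(g,h,r)\mapsto g$, target $(g,h,r)\mapsto r$, product $(g,h,r)(r,h',r')=(g,hh',r')$, identities $(g,\epsilon(\alpha(g)),g)$ and inverses $(r,h^{-1},g)$, and let $i_{G_2}:G_2\to\mathcal P^\alpha G$, $i_{G_2}(g,h)=(g,g,h)$. Let $\tilde\alpha,\tilde\beta:T^*(\mathcal P^\alpha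 G)\to A^*(\mathcal P^\alpha G)$ be the source and target of the cotangent groupoid: for $\nu\in T^*_p(\mathcal P^\alpha G)$, $\tilde\beta(\nu)(z)=\nu(T\ell_p z)$ for $z$ in the fibre of $A(\mathcal P^\alpha G)$ over the target of $p$, and $\tilde\alpha(\nu)(z)=\nu(-T(r_p\circ i)z)$ for $z$ in the fibre over the source of $p$. Let $L_d:G_2\to\mathbb R$ be smooth, and let $$\Sigma_{L_d}=\{\nu\in T^*(\mathcal P^\alpha G): \nu \text{ lies over } i_{G_2}(G_2) \text{ and } i_{G_2}^*\nu=dL_d\}.$$ Let $g_1,\dots,g_N\in G$ with $(g_k,g_{k+1})\in G_2$ for $1\le k\le N-1$, and let $\gamma_k=\gamma_{(g_k,g_{k+1})}\in T^*_{(g_k,g_k,g_{k+1})}(\mathcal P^\alpha G)$ for $1\le k\le N-1$. The sequence $(\gamma_k)$ satisfies the discrete second-order dynamics on $\Sigma_{L_d}$ if $\gamma_k\in\Sigma_{L_d}$ for all $k$ and $\tilde\alpha(\gamma_{k})=\tilde\beta(\gamma_{k-1})$ for $2\le k\le N-1$. A triple $(\mu,\tilde\mu,\bar\mu)\in T^*_{g_k}G\times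 T^*_{g_k}G\times T^*_{g_{k+1}}G$ represents $\gamma_k$ if $\gamma_k(u,v,w)=\mu(u)+\tilde\mu(v)+\bar\mu(w)$ for all $(u,v,w)$ tangent to $\mathcal P^\alpha G$ at $(g_k,g_k,g_{k+1})$. For each $k$ let $D_1L_d(g_k,g_{k+1})\in T^*_{g_k}G$ and $D_2L_d(g_k,g_{k+1})\in T^*_{g_{k+1}}G$ be the partial differentials of any smooth extension of $L_d$ to a neighbourhood of $(g_k,g_{k+1})$ in $G\times G$. Then: (a) $(\gamma_k)$ satisfies the discrete second-order dynamics on $\Sigma_{L_d}$ if and only if there are triples $(\mu_{g_k},\tilde\mu_{g_k},\bar\mu_{g_{k+1}})$ representing $\gamma_k$ $(1\le k\le N-1)$ such that $$\langle\overleftarrow X(g_k),\tilde\mu_{g_k}\rangle+\langle Y(g_{k+1}),\bar\mu_{g_{k+1}}\rangle=\langle\overrightarrow X(g_{k+1}),\tilde\mu_{g_{k+1}}\rangle-\langle Y(g_{k+1}),\mu_{g_{k+1}}\rangle,\qquad 1\le k\le N-2,\tag{1}$$ for every smooth section $X$ of $AG$ and every smooth vector field $Y$ on $G$ with $T\beta(X(\alpha(g)))=T\alpha(Y(g))$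 for all $g\in G$, and $$\mu_{g_k}+\tilde\mu_{g_k}=D_1L_d(g_k,g_{k+1}),\qquad \bar\mu_{g_{k+1}}=D_2L_d(g_k,g_{k+1}),\qquad 1\le k\le N-1.\tag{2}$$ (b) For any given triples $(\mu_{g_k},\tilde\mu_{g_k},\bar\mu_{g_{k+1}})$ representing $\gamma_k$, the sequence $(\gamma_k)$ satisfies the discrete second-order dynamics on $\Sigma_{L_d}$ if and only if (1) holds and the equations (2) hold on $G_2$, that is, $(\mu_{g_k}+\tilde\mu_{g_k})(u)+\bar\mu_{g_{k+1}}(w)=D_1L_d(g_k,g_{k+1})(u)+D_2L_d(g_k,g_{k+1})(w)$ for all $(u,w)\in T_{(g_k,g_{k+1})}G_2$ and $1\le k\le N-1$. -/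

import Mathlib

open scoped Manifold ContDiff Topology

noncomputable section

/-! ### Submanifolds of a manifold, given as subsets -/

section Subsets

variable {E : Type*} [NormedAddCommGroup E] [NormedSpace ℝ E]
  {H : Type*} [TopologicalSpace H] (I : ModelWithCorners ℝ E H)
  {M : Type*} [TopologicalSpace M] [ChartedSpace H M]
  {E' : Type*} [NormedAddCommGroup E'] [NormedSpace ℝ E']
  {H' : Type*} [TopologicalSpace H'] (I' : ModelWithCorners ℝ E' H')
  {N : Type*} [TopologicalSpace N] [ChartedSpace H' N]

/-- `v` is the velocity at time `0` of a curve through `p` which lies in `S`. -/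
def IsVelocityIn (S : Set M) (p : M) (v : TangentSpace I p) : Prop :=
  ∃ c : ℝ → M, c 0 = p ∧ (∀ᶠ t in 𝓝 (0 : ℝ), c t ∈ S) ∧
    HasMFDerivAt 𝓘(ℝ, ℝ) I c 0
      (ContinuousLinearMap.toSpanSingleton ℝ (v : E) : ℝ →L[ℝ] E)

/-- The tangent space at `p` of a subset `S` of a manifold: the span of the velocities of curves
in `S`. For an embedded submanifold these velocities already form a linear space, which is the
usual tangent space `T_p S`, regarded as a subspace of the tangent space of the ambient manifold. -/
def tangentSubspace (S : Set M) (p : M) : Submodule ℝ (TangentSpace I p) :=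
  Submodule.span ℝ {v | IsVelocityIn I S p v}

/-- A map defined on a subset `S` of a manifold is smooth if locally it extends to a smooth map on
an open set of the ambient manifold. -/
def SmoothOnSubset (S : Set M) (f : S → N) : Prop :=
  ∀ p : S, ∃ U : Set M, IsOpen U ∧ (p : M) ∈ U ∧ ∃ F : M → N,
    ContMDiffOn I I' ∞ F U ∧ ∀ x : S, (x : M) ∈ U → F x = f x

variable {I I'} in
theorem mfderivWithin_mem_tangentSubspace {S : Set M} {S' : Set N} {f : M → N}
    (hf : Set.MapsTo f S S') {p : M} {y : N} (hy : f p = y) {v : TangentSpace I p}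
    (hv : v ∈ tangentSubspace I S p) :
    (show TangentSpace I' y from mfderivWithin I I' f S p v) ∈ tangentSubspace I' S' y := by
  subst hy
  by_cases hd : MDifferentiableWithinAt I I' f S p
  · refine Submodule.span_induction (p := fun v _ =>
      (mfderivWithin I I' f S p v) ∈ tangentSubspace I' S' (f p)) ?_ ?_ ?_ ?_ hv
    · rintro w ⟨c, hc0, hcS, hc⟩
      subst hc0
      refine Submodule.subset_span ⟨f ∘ c, rfl, hcS.mono fun t ht => hf ht, ?_⟩
      have h := HasMFDerivWithinAt.hasMFDerivAt
        (HasMFDerivWithinAt.comp (0 : ℝ) hd.hasMFDerivWithinAt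
          (HasMFDerivAt.hasMFDerivWithinAt (s := c ⁻¹' S) hc) subset_rfl) hcS
      have e : (ContinuousLinearMap.toSpanSingleton ℝ
          (show E' from mfderivWithin I I' f S (c 0) w) : ℝ →L[ℝ] E') =
          (show E →L[ℝ] E' from mfderivWithin I I' f S (c 0)) ∘L
            (ContinuousLinearMap.toSpanSingleton ℝ (show E from w)) :=
        ContinuousLinearMap.ext fun t =>
          ((show E →L[ℝ] E' from mfderivWithin I I' f S (c 0)).map_smul t (show E from w)).symm
      exact (congrArg (fun D : ℝ →L[ℝ] E' => HasMFDerivAt 𝓘(ℝ, ℝ) I' (f ∘ c) 0 D) e).mpr h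
    · simp
    · intro a b _ _ ha hb
      rw [map_add]
      exact add_mem ha hb
    · intro a b _ hb
      rw [map_smul]
      exact Submodule.smul_mem _ _ hb
  · rw [mfderivWithin_zero_of_not_mdifferentiableWithinAt hd]
    exact Submodule.zero_mem _

/-- The tangent map `T_p f : T_p S → T_y S'` of a map `f : S → S'` between submanifolds, where
`y = f p`. Values of `f` outside `S` play no role. -/
def tangentMapOn {S : Set M} {S' : Set N} (f : M → N) (hf : Set.MapsTo f S S') (p : M) (y : N)
    (hy : f p = y) : tangentSubspace I S p →L[ℝ] tangentSubspace I' S' y :=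
  ContinuousLinearMap.codRestrict
    ((show TangentSpace I p →L[ℝ] TangentSpace I' y from mfderivWithin I I' f S p) ∘L
      (tangentSubspace I S p).subtypeL)
    (tangentSubspace I' S' y)
    (fun v => mfderivWithin_mem_tangentSubspace hf hy v.2)

/-- The cotangent space `T*_p S` of a submanifold `S`. -/
abbrev CotangentSpaceOf (S : Set M) (p : M) : Type _ := tangentSubspace I S p →L[ℝ] ℝ

/-- The cotangent bundle `T* S` of a submanifold `S`. -/
abbrev CotangentBundleOf (S : Set M) : Type _ := Σ p : S, CotangentSpaceOf I S (p : M)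

/-- The differential at `p` of a real function defined on a submanifold `S`, as an element of
`T*_p S`. -/
def differentialOn {S : Set M} (f : S → ℝ) (p : M) : CotangentSpaceOf I S p :=
  (show TangentSpace I p →L[ℝ] ℝ from
    mfderivWithin I 𝓘(ℝ, ℝ) (Function.extend Subtype.val f 0) S p) ∘L
      (tangentSubspace I S p).subtypeL

end Subsets

/-! ### Groupoids -/

/-- A groupoid with set of objects `Q`, whose set of arrows is the subset `arrows` of `M`. The
values of the structural maps outside `arrows`, and of `mul` outside the composable pairs, are
irrelevant. -/
structure SetGroupoid (M Q : Type*) where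
  arrows : Set M
  src : M → Q
  tgt : M → Q
  one : Q → M
  inv : M → M
  mul : M → M → M
  one_mem : ∀ q, one q ∈ arrows
  inv_mem : ∀ g ∈ arrows, inv g ∈ arrows
  mul_mem : ∀ g ∈ arrows, ∀ h ∈ arrows, tgt g = src h → mul g h ∈ arrows
  src_one : ∀ q, src (one q) = q
  tgt_one : ∀ q, tgt (one q) = q
  src_inv : ∀ g ∈ arrows, src (inv g) = tgt g
  tgt_inv : ∀ g ∈ arrows, tgt (inv g) = src g
  src_mul : ∀ g ∈ arrows, ∀ h ∈ arrows, tgt g = src h → src (mul g h) = src g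
  tgt_mul : ∀ g ∈ arrows, ∀ h ∈ arrows, tgt g = src h → tgt (mul g h) = tgt h
  mul_assoc : ∀ g ∈ arrows, ∀ h ∈ arrows, ∀ k ∈ arrows, tgt g = src h → tgt h = src k →
    mul (mul g h) k = mul g (mul h k)
  one_mul : ∀ g ∈ arrows, mul (one (src g)) g = g
  mul_one : ∀ g ∈ arrows, mul g (one (tgt g)) = g
  mul_inv : ∀ g ∈ arrows, mul g (inv g) = one (src g)
  inv_mul : ∀ g ∈ arrows, mul (inv g) g = one (tgt g)

namespace SetGroupoid

section Basic

variable {M Q : Type*} (Γ : SetGroupoid M Q)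

/-- The set of composable pairs. -/
def composable : Set (M × M) :=
  {p | p.1 ∈ Γ.arrows ∧ p.2 ∈ Γ.arrows ∧ Γ.tgt p.1 = Γ.src p.2}

/-- The fibre of the source map over `q`. -/
def srcFibre (q : Q) : Set M := {x | x ∈ Γ.arrows ∧ Γ.src x = q}

theorem inv_one (q : Q) : Γ.inv (Γ.one q) = Γ.one q := by
  have h := Γ.mul_one _ (Γ.inv_mem _ (Γ.one_mem q))
  rw [Γ.tgt_inv _ (Γ.one_mem q), Γ.src_one, Γ.inv_mul _ (Γ.one_mem q), Γ.tgt_one] at h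
  exact h.symm

/-- The left translation by `g` maps the source fibre over `tgt g` to arrows. -/
theorem mapsTo_left {g : M} (hg : g ∈ Γ.arrows) :
    Set.MapsTo (fun x => Γ.mul g x) (Γ.srcFibre (Γ.tgt g)) Γ.arrows :=
  fun x hx => Γ.mul_mem g hg x hx.1 hx.2.symm

/-- The inversion followed by the right translation by `g` maps the source fibre over `src g` to
arrows. -/
theorem mapsTo_right {g : M} (hg : g ∈ Γ.arrows) :
    Set.MapsTo (fun x => Γ.mul (Γ.inv x) g) (Γ.srcFibre (Γ.src g)) Γ.arrows :=
  fun x hx => Γ.mul_mem _ (Γ.inv_mem x hx.1) g hg ((Γ.tgt_inv x hx.1).trans hx.2)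

end Basic

section Differential

variable {E : Type*} [NormedAddCommGroup E] [NormedSpace ℝ E]
  {H : Type*} [TopologicalSpace H] (I : ModelWithCorners ℝ E H)
  {M : Type*} [TopologicalSpace M] [ChartedSpace H M] {Q : Type*} (Γ : SetGroupoid M Q)

/-- The fibre `A_q` of the associated Lie algebroid: the tangent space at the identity of `q` of
the source fibre over `q`. -/
abbrev algebroidFibre (q : Q) : Submodule ℝ (TangentSpace I (Γ.one q)) :=
  tangentSubspace I (Γ.srcFibre q) (Γ.one q)

/-- `a ↦ (T ℓ_g) a`: the value at `g` of the left-invariant vector field with value `a` at the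
identity of `tgt g`. -/
def leftInvariant (g : M) (hg : g ∈ Γ.arrows) :
    Γ.algebroidFibre I (Γ.tgt g) →L[ℝ] tangentSubspace I Γ.arrows g :=
  tangentMapOn I I (fun x => Γ.mul g x) (Γ.mapsTo_left hg) (Γ.one (Γ.tgt g)) g (Γ.mul_one g hg)

/-- `a ↦ -T(r_g ∘ i) a`: the value at `g` of the right-invariant vector field associated with `a`
at the identity of `src g`. -/
def rightInvariant (g : M) (hg : g ∈ Γ.arrows) :
    Γ.algebroidFibre I (Γ.src g) →L[ℝ] tangentSubspace I Γ.arrows g :=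
  -tangentMapOn I I (fun x => Γ.mul (Γ.inv x) g) (Γ.mapsTo_right hg) (Γ.one (Γ.src g)) g
    (by simp only [Γ.inv_one, Γ.one_mul g hg])

/-- The dual bundle `A*` of the associated Lie algebroid. -/
abbrev DualAlgebroid : Type _ := Σ q : Q, (Γ.algebroidFibre I q →L[ℝ] ℝ)

/-- The source map of the cotangent groupoid. -/
def cotangentSrc (μ : CotangentBundleOf I Γ.arrows) : Γ.DualAlgebroid I :=
  ⟨Γ.src μ.1, μ.2 ∘L Γ.rightInvariant I μ.1 μ.1.2⟩

/-- The target map of the cotangent groupoid. -/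
def cotangentTgt (μ : CotangentBundleOf I Γ.arrows) : Γ.DualAlgebroid I :=
  ⟨Γ.tgt μ.1, μ.2 ∘L Γ.leftInvariant I μ.1 μ.1.2⟩

end Differential

end SetGroupoid

/-! ### Lie groupoids -/

/-- A Lie groupoid with manifold of arrows `G` and manifold of objects `Q`. -/
structure LieGroupoid (E F : Type*) [NormedAddCommGroup E] [NormedSpace ℝ E]
    [NormedAddCommGroup F] [NormedSpace ℝ F]
    (G Q : Type*) [TopologicalSpace G] [ChartedSpace E G]
    [TopologicalSpace Q] [ChartedSpace F Q] extends SetGroupoid G Q where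
  arrows_eq : arrows = Set.univ
  contMDiff_src : ContMDiff 𝓘(ℝ, E) 𝓘(ℝ, F) ∞ src
  contMDiff_tgt : ContMDiff 𝓘(ℝ, E) 𝓘(ℝ, F) ∞ tgt
  submersion_src : ∀ g, Function.Surjective (mfderiv 𝓘(ℝ, E) 𝓘(ℝ, F) src g)
  submersion_tgt : ∀ g, Function.Surjective (mfderiv 𝓘(ℝ, E) 𝓘(ℝ, F) tgt g)
  contMDiff_one : ContMDiff 𝓘(ℝ, F) 𝓘(ℝ, E) ∞ one
  contMDiff_inv : ContMDiff 𝓘(ℝ, E) 𝓘(ℝ, E) ∞ inv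
  smooth_mul : SmoothOnSubset (𝓘(ℝ, E).prod 𝓘(ℝ, E)) 𝓘(ℝ, E) toSetGroupoid.composable
    (fun p => mul p.1.1 p.1.2)

namespace LieGroupoid

variable {E F : Type*} [NormedAddCommGroup E] [NormedSpace ℝ E]
  [NormedAddCommGroup F] [NormedSpace ℝ F]
  {G Q : Type*} [TopologicalSpace G] [ChartedSpace E G]
  [TopologicalSpace Q] [ChartedSpace F Q]

section Algebra

variable (Γ : LieGroupoid E F G Q)

theorem mem (g : G) : g ∈ Γ.arrows := by rw [Γ.arrows_eq]; trivial

/-- The prolongation of a Lie groupoid `G` over its source map: a groupoid over `G` whose arrows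
are the triples `(g, h, r)` with `src g = src h` and `tgt h = src r`. -/
def prolongation : SetGroupoid (G × G × G) G where
  arrows := {p | Γ.src p.1 = Γ.src p.2.1 ∧ Γ.tgt p.2.1 = Γ.src p.2.2}
  src p := p.1
  tgt p := p.2.2
  one g := (g, Γ.one (Γ.src g), g)
  inv p := (p.2.2, Γ.inv p.2.1, p.1)
  mul p p' := (p.1, Γ.mul p.2.1 p'.2.1, p'.2.2)
  one_mem g := ⟨(Γ.src_one _).symm, Γ.tgt_one _⟩
  inv_mem p hp := ⟨by simp [Γ.src_inv _ (Γ.mem _), hp.2], by simp [Γ.tgt_inv _ (Γ.mem _), hp.1]⟩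
  mul_mem p hp p' hp' h := by
    have hc : Γ.tgt p.2.1 = Γ.src p'.2.1 := by rw [hp.2, h, hp'.1]
    exact ⟨by simp [Γ.src_mul _ (Γ.mem _) _ (Γ.mem _) hc, hp.1],
      by simp [Γ.tgt_mul _ (Γ.mem _) _ (Γ.mem _) hc, hp'.2]⟩
  src_one _ := rfl
  tgt_one _ := rfl
  src_inv _ _ := rfl
  tgt_inv _ _ := rfl
  src_mul _ _ _ _ _ := rfl
  tgt_mul _ _ _ _ _ := rfl
  mul_assoc p hp p' hp' p'' hp'' h h' := by
    have hc : Γ.tgt p.2.1 = Γ.src p'.2.1 := by rw [hp.2, h, hp'.1]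
    have hc' : Γ.tgt p'.2.1 = Γ.src p''.2.1 := by rw [hp'.2, h', hp''.1]
    simp [Γ.mul_assoc _ (Γ.mem _) _ (Γ.mem _) _ (Γ.mem _) hc hc']
  one_mul p hp := by
    have h := Γ.one_mul _ (Γ.mem p.2.1)
    rw [← hp.1] at h
    simp [h]
  mul_one p hp := by
    have h := Γ.mul_one _ (Γ.mem p.2.1)
    rw [hp.2] at h
    simp [h]
  mul_inv p hp := by simp [Γ.mul_inv _ (Γ.mem _), hp.1]
  inv_mul p hp := by simp [Γ.inv_mul _ (Γ.mem _), hp.2]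

/-- The inclusion of the composable pairs in the prolongation, `(g, h) ↦ (g, g, h)`. -/
def inclusion (p : G × G) : G × G × G := (p.1, p.1, p.2)

theorem mapsTo_inclusion : Set.MapsTo inclusion Γ.composable Γ.prolongation.arrows :=
  fun _ hp => ⟨rfl, hp.2.2⟩

end Algebra

section Cotangent

variable (Γ : LieGroupoid E F G Q)

/-- The cotangent space of the prolongation at a point of `G × G × G`. -/
abbrev ProlongationCovector (p : G × G × G) : Type _ :=
  CotangentSpaceOf (𝓘(ℝ, E).prod (𝓘(ℝ, E).prod 𝓘(ℝ, E))) Γ.prolongation.arrows p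

/-- The cotangent bundle of the prolongation. -/
abbrev ProlongationCotangent : Type _ :=
  CotangentBundleOf (𝓘(ℝ, E).prod (𝓘(ℝ, E).prod 𝓘(ℝ, E))) Γ.prolongation.arrows

/-- The covector `(μ, μ', μ'')` of the prolongation at `(g, h, r)`: the restriction of the covector
`(u, v, w) ↦ μ u + μ' v + μ'' w` of `G × G × G`. -/
def covectorOfComponents {g h r : G} (μ : TangentSpace 𝓘(ℝ, E) g →L[ℝ] ℝ)
    (μ' : TangentSpace 𝓘(ℝ, E) h →L[ℝ] ℝ) (μ'' : TangentSpace 𝓘(ℝ, E) r →L[ℝ] ℝ) :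
    Γ.ProlongationCovector (g, h, r) :=
  (show TangentSpace (𝓘(ℝ, E).prod (𝓘(ℝ, E).prod 𝓘(ℝ, E))) (g, h, r) →L[ℝ] ℝ from
    ContinuousLinearMap.coprod (M₁ := TangentSpace 𝓘(ℝ, E) g)
      (M₂ := TangentSpace 𝓘(ℝ, E) h × TangentSpace 𝓘(ℝ, E) r) μ
      (ContinuousLinearMap.coprod (M₁ := TangentSpace 𝓘(ℝ, E) h)
        (M₂ := TangentSpace 𝓘(ℝ, E) r) μ' μ'')) ∘L
    (tangentSubspace (𝓘(ℝ, E).prod (𝓘(ℝ, E).prod 𝓘(ℝ, E))) Γ.prolongation.arrows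
      (g, h, r)).subtypeL

/-- The subset `Σ_L` of the cotangent bundle of the prolongation generated by a function `L` on the
composable pairs: the covectors at points `(g, g, h)` whose pull-back to the composable pairs is
the differential of `L`. -/
def generated (L : Γ.composable → ℝ) : Set Γ.ProlongationCotangent :=
  {μ | ∃ (c : Γ.composable) (hc : inclusion (c : G × G) = (μ.1 : G × G × G)),
    μ.2 ∘L tangentMapOn (𝓘(ℝ, E).prod 𝓘(ℝ, E)) (𝓘(ℝ, E).prod (𝓘(ℝ, E).prod 𝓘(ℝ, E)))
        inclusion Γ.mapsTo_inclusion (c : G × G) (μ.1 : G × G × G) hc =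
      differentialOn (𝓘(ℝ, E).prod 𝓘(ℝ, E)) L (c : G × G)}

/-- The discrete second-order dynamics on `Σ_L`: all terms of the finite sequence lie in `Σ_L` and
successive terms are composable in the cotangent groupoid of the prolongation. -/
def SecondOrderDynamics (L : Γ.composable → ℝ) {n : ℕ}
    (c : Fin n → Γ.ProlongationCotangent) : Prop :=
  (∀ k, c k ∈ Γ.generated L) ∧
    ∀ (k : ℕ) (hk : k + 1 < n),
      Γ.prolongation.cotangentSrc (𝓘(ℝ, E).prod (𝓘(ℝ, E).prod 𝓘(ℝ, E))) (c ⟨k + 1, hk⟩) =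
      Γ.prolongation.cotangentTgt (𝓘(ℝ, E).prod (𝓘(ℝ, E).prod 𝓘(ℝ, E)))
        (c ⟨k, Nat.lt_of_succ_lt hk⟩)

/-- The sequence in the cotangent bundle of the prolongation with terms `γ_k` at the points
`(g_k, g_k, g_{k+1})`, for `k < n`. -/
def covectorSequence {n : ℕ} (g : ℕ → G) (hg : ∀ k < n, Γ.tgt (g k) = Γ.src (g (k + 1)))
    (γ : ∀ k, Γ.ProlongationCovector (g k, g k, g (k + 1))) (k : Fin n) :
    Γ.ProlongationCotangent :=
  ⟨⟨(g k, g k, g (k + 1)), rfl, hg k k.2⟩, γ k⟩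

/-- `D₁` and `D₂` are the partial differentials at the composable pair `(g, h)` of a smooth
function, defined on `G × G` near `(g, h)`, which coincides with `L` on the composable pairs. -/
def IsPartialDifferentials (L : Γ.composable → ℝ) (g h : G)
    (D₁ : TangentSpace 𝓘(ℝ, E) g →L[ℝ] ℝ) (D₂ : TangentSpace 𝓘(ℝ, E) h →L[ℝ] ℝ) : Prop :=
  ∃ U : Set (G × G), IsOpen U ∧ (g, h) ∈ U ∧ ∃ f : G × G → ℝ,
    ContMDiffOn (𝓘(ℝ, E).prod 𝓘(ℝ, E)) 𝓘(ℝ, ℝ) ∞ f U ∧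
    (∀ c : Γ.composable, (c : G × G) ∈ U → f c = L c) ∧
    D₁ = mfderiv 𝓘(ℝ, E) 𝓘(ℝ, ℝ) (fun x => f (x, h)) g ∧
    D₂ = mfderiv 𝓘(ℝ, E) 𝓘(ℝ, ℝ) (fun y => f (g, y)) h

end Cotangent

section Sections

variable [IsManifold 𝓘(ℝ, E) ∞ G] (Γ : LieGroupoid E F G Q)

/-- The smooth sections of the Lie algebroid `AG → Q`. -/
structure AlgebroidSection where
  toFun : ∀ q : Q, Γ.algebroidFibre 𝓘(ℝ, E) q
  contMDiff : ContMDiff 𝓘(ℝ, F) 𝓘(ℝ, E).tangent ∞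
    (fun q => (⟨Γ.one q, (toFun q : TangentSpace 𝓘(ℝ, E) (Γ.one q))⟩ : TangentBundle 𝓘(ℝ, E) G))

/-- The left-invariant vector field of a section of the Lie algebroid. -/
def AlgebroidSection.left {Γ : LieGroupoid E F G Q} (X : Γ.AlgebroidSection) (g : G) :
    TangentSpace 𝓘(ℝ, E) g :=
  (Γ.leftInvariant 𝓘(ℝ, E) g (Γ.mem g) (X.toFun (Γ.tgt g)) : TangentSpace 𝓘(ℝ, E) g)

/-- The right-invariant vector field of a section of the Lie algebroid. -/
def AlgebroidSection.right {Γ : LieGroupoid E F G Q} (X : Γ.AlgebroidSection) (g : G) :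
    TangentSpace 𝓘(ℝ, E) g :=
  (Γ.rightInvariant 𝓘(ℝ, E) g (Γ.mem g) (X.toFun (Γ.src g)) : TangentSpace 𝓘(ℝ, E) g)

/-- The sections `Z = (X, Y)` of the Lie algebroid of the prolongation: a section `X` of `AG` and a
vector field `Y` on `G` with `Tβ (X (α g)) = Tα (Y g)` for all `g`. -/
structure ProlongationSection where
  X : Γ.AlgebroidSection
  Y : ∀ g : G, TangentSpace 𝓘(ℝ, E) g
  contMDiff_Y : ContMDiff 𝓘(ℝ, E) 𝓘(ℝ, E).tangent ∞
    (fun g => (⟨g, Y g⟩ : TangentBundle 𝓘(ℝ, E) G))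
  compat : ∀ g : G,
    tangentMap 𝓘(ℝ, E) 𝓘(ℝ, F) Γ.tgt
        ⟨Γ.one (Γ.src g), (X.toFun (Γ.src g) : TangentSpace 𝓘(ℝ, E) (Γ.one (Γ.src g)))⟩ =
      tangentMap 𝓘(ℝ, E) 𝓘(ℝ, F) Γ.src ⟨g, Y g⟩

/-- The pairing equations
`⟨X⃖(g_k), μ'_k⟩ + ⟨Y(g_{k+1}), μ''_k⟩ = ⟨X⃗(g_{k+1}), μ'_{k+1}⟩ - ⟨Y(g_{k+1}), μ_{k+1}⟩`
for all sections `(X, Y)` and all `k` with `k + 1 < n`. -/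
def PairingEquations (n : ℕ) (g : ℕ → G) (μ μ' : ∀ k, TangentSpace 𝓘(ℝ, E) (g k) →L[ℝ] ℝ)
    (μ'' : ∀ k, TangentSpace 𝓘(ℝ, E) (g (k + 1)) →L[ℝ] ℝ) : Prop :=
  ∀ Z : Γ.ProlongationSection, ∀ k, k + 1 < n →
    μ' k (Z.X.left (g k)) + μ'' k (Z.Y (g (k + 1))) =
      μ' (k + 1) (Z.X.right (g (k + 1))) - μ (k + 1) (Z.Y (g (k + 1)))

end Sections

end LieGroupoid

end

/-! A covector of the prolongation is the restriction of a covector `(μ, μ', μ'')` of `G × G × G`,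
and the components are ambiguous only by covectors that vanish on the prolongation. For an arbitrary
choice of components, `secondOrderDynamics_iff` turns composability into the pairing equations (1)
and membership in `Σ_L` into (2) restricted to vectors tangent to the composable pairs. This is (b).

For composability, the algebroid fibre of the prolongation over `h` consists of the vectors `(0, v,
w)` with `Tα v = 0` and `Tβ v = Tα w`. Left translation by `(g, g, h)` sends such a vector to `(0,
Tℓ_g v, w)`, and the signed right translation by `(h, h, r)` sends it to `(-w, -T(r_h ∘ i) v, 0)`.
Pairing with the components gives (1) at one vector. To pass from all sections to all vectors, each
vector must be the value of a global section, which is `exists_prolongationSection`. There `v`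
extends to a global α-vertical field by a bump function. The field `T(r ∘ i) X` has the α-projection
required of `Y`, and adding a vertical field gives it the value `w` at the chosen point.

For membership in `Σ_L`, the inclusion has tangent map `(u, w) ↦ (u, u, w)`, so the condition
compares `(μ + μ', μ'')` with `(D₁, D₂)` on vectors with `Tβ u = Tα w`. For (a) the two must agree
on all vectors (`exists_components_of_pullback_eq`). Testing on `(0, w)` shows that `μ'' - D₂`
vanishes on `ker Tα`, so it is `λ ∘ Tα`. Since `Tβ v = Tα w` on the prolongation, this term moves to
the middle slot as `λ ∘ Tβ` without changing the covector. By (b) the new components again satisfy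
(1).

Tangent spaces are spans of velocities of curves. A vector is therefore shown to be tangent by
lifting curves along submersions, and linear relations between tangent vectors follow because a
derivative within a subset is determined on its tangent space. -/

noncomputable section

/-! ### Lifting curves along submersions -/

section CurveLifting

variable {E F : Type*} [NormedAddCommGroup E] [NormedSpace ℝ E]
  [NormedAddCommGroup F] [NormedSpace ℝ F]

/-- Curves lift along a map with surjective strict derivative, with any compatible velocity. -/
theorem HasStrictFDerivAt.exists_curve_lift [FiniteDimensional ℝ E] [FiniteDimensional ℝ F]
    {f : E → F} {A : E →L[ℝ] F} {x : E}
    (hf : HasStrictFDerivAt f A x) (hA : Function.Surjective A) {b : ℝ → F} {v : E}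
    (hb : HasDerivAt b (A v) 0) (hb0 : b 0 = f x) :
    ∃ c : ℝ → E, c 0 = x ∧ HasDerivAt c v 0 ∧ ∀ᶠ t in 𝓝 0, f (c t) = b t := by
  obtain ⟨R, hR'⟩ := A.exists_rightInverse_of_surjective (LinearMap.range_eq_top.2 hA)
  have hR : ∀ y, A (R y) = y := fun y => DFunLike.congr_fun hR' y
  -- `Φ` straightens `f`: its derivative at `x` is the identity and `A ∘ Φ = f`, so lifting along
  -- `f` reduces to lifting along the linear map `A`.
  set Φ : E → E := fun y => y - R (A y) + R (f y) with hΦ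
  have hΦ' : HasStrictFDerivAt Φ ((ContinuousLinearEquiv.refl ℝ E : E ≃L[ℝ] E) : E →L[ℝ] E) x := by
    have h := ((hasStrictFDerivAt_id x).sub ((R ∘L A).hasStrictFDerivAt (x := x))).add
      (R.hasStrictFDerivAt.comp x hf)
    rw [sub_add_cancel] at h
    exact h
  have hAΦ : ∀ y, A (Φ y) = f y := fun y => by simp [hΦ, hR]
  set Ψ := hΦ'.localInverse with hΨ
  -- The line with velocity `v`, corrected so that `A (y t) = b t`. The correction has zero
  -- derivative at `0` because `b` has velocity `A v`.
  let y : ℝ → E := fun t => Φ x + t • v + R (b t - b 0 - t • A v)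
  have hy0 : y 0 = Φ x := by simp [y]
  have hy : HasDerivAt y v 0 := by
    have h1 : HasDerivAt (fun t : ℝ => b t - b 0 - t • A v) 0 0 := by
      simpa using! (hb.sub_const (b 0)).sub ((hasDerivAt_id (0 : ℝ)).smul_const (A v))
    have h2 := R.hasFDerivAt.comp_hasDerivAt (0 : ℝ) h1
    have h3 := (((hasDerivAt_id (0 : ℝ)).smul_const v).const_add (Φ x)).add h2
    simpa using! h3
  have hΨd : HasStrictFDerivAt Ψ (ContinuousLinearMap.id ℝ E) (y 0) := by
    rw [hy0]; simpa using! hΦ'.to_localInverse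
  refine ⟨fun t => Ψ (y t), ?_, ?_, ?_⟩
  · simp only [hy0]
    exact hΦ'.localInverse_apply_image
  · simpa using! hΨd.hasFDerivAt.comp_hasDerivAt (0 : ℝ) hy
  · have ht : Filter.Tendsto y (𝓝 0) (𝓝 (Φ x)) := hy0 ▸ hy.continuousAt.tendsto
    filter_upwards [ht.eventually hΦ'.eventually_right_inverse] with t h
    rw [← hAΦ]
    have : Φ (Ψ (y t)) = y t := h
    rw [this]
    simp [y, hR, hAΦ, hb0]

variable {G Q : Type*} [TopologicalSpace G] [ChartedSpace E G]
  [TopologicalSpace Q] [ChartedSpace F Q]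

theorem hasDerivAt_extChartAt_comp {b : ℝ → Q} {w : F}
    (hb : HasMFDerivAt 𝓘(ℝ, ℝ) 𝓘(ℝ, F) b 0 (ContinuousLinearMap.toSpanSingleton ℝ w : ℝ →L[ℝ] F)) :
    HasDerivAt (fun t => extChartAt 𝓘(ℝ, F) (b 0) (b t)) w 0 := by
  have h : HasFDerivWithinAt (fun t => extChartAt 𝓘(ℝ, F) (b 0) (b t))
      (ContinuousLinearMap.toSpanSingleton ℝ w : ℝ →L[ℝ] F) (Set.range (id : ℝ → ℝ)) 0 := hb.2
  rw [Set.range_id, hasFDerivWithinAt_univ] at h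
  simpa using h.hasDerivAt

theorem hasMFDerivAt_extChartAt_symm_comp [IsManifold 𝓘(ℝ, E) 1 G] {p : G} {c : ℝ → E} {v : E}
    (hc0 : c 0 = extChartAt 𝓘(ℝ, E) p p) (hc : HasDerivAt c v 0) :
    HasMFDerivAt 𝓘(ℝ, ℝ) 𝓘(ℝ, E) (fun t => (extChartAt 𝓘(ℝ, E) p).symm (c t)) 0
      (ContinuousLinearMap.toSpanSingleton ℝ v : ℝ →L[ℝ] E) := by
  have h0 : (extChartAt 𝓘(ℝ, E) p).symm (c 0) = p := by simp [hc0]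
  have hcont : ContinuousAt (fun t => (extChartAt 𝓘(ℝ, E) p).symm (c t)) 0 := by
    refine ContinuousAt.comp (f := c) ?_ hc.continuousAt
    rw [hc0]; exact continuousAt_extChartAt_symm p
  refine ⟨hcont, ?_⟩
  have e : (fun t => extChartAt 𝓘(ℝ, E) p ((extChartAt 𝓘(ℝ, E) p).symm (c t))) =ᶠ[𝓝 0] c := by
    have ht : (extChartAt 𝓘(ℝ, E) p).target ∈ 𝓝 (c 0) := by
      rw [hc0]; exact extChartAt_target_mem_nhds p
    filter_upwards [hc.continuousAt.preimage_mem_nhds ht] with t h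
    exact (extChartAt 𝓘(ℝ, E) p).right_inv h
  have h : HasFDerivWithinAt (fun t => extChartAt 𝓘(ℝ, E) ((extChartAt 𝓘(ℝ, E) p).symm (c 0))
      ((extChartAt 𝓘(ℝ, E) p).symm (c t)))
      (ContinuousLinearMap.toSpanSingleton ℝ v : ℝ →L[ℝ] E) (Set.range (id : ℝ → ℝ)) 0 := by
    rw [Set.range_id, hasFDerivWithinAt_univ, h0]
    exact hc.hasFDerivAt.congr_of_eventuallyEq e
  exact h

/-- Curves lift along a submersion, with any compatible velocity. -/
theorem exists_curve_lift [FiniteDimensional ℝ E] [FiniteDimensional ℝ F]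
    [IsManifold 𝓘(ℝ, E) 1 G] {f : G → Q} {p : G}
    (hf : ContMDiffAt 𝓘(ℝ, E) 𝓘(ℝ, F) ∞ f p)
    (hs : Function.Surjective (mfderiv 𝓘(ℝ, E) 𝓘(ℝ, F) f p)) {b : ℝ → Q} {w : F} {v : E}
    (hb0 : b 0 = f p)
    (hb : HasMFDerivAt 𝓘(ℝ, ℝ) 𝓘(ℝ, F) b 0 (ContinuousLinearMap.toSpanSingleton ℝ w : ℝ →L[ℝ] F))
    (hv : (mfderiv 𝓘(ℝ, E) 𝓘(ℝ, F) f p : E →L[ℝ] F) v = w) :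
    ∃ c : ℝ → G, c 0 = p ∧
      HasMFDerivAt 𝓘(ℝ, ℝ) 𝓘(ℝ, E) c 0 (ContinuousLinearMap.toSpanSingleton ℝ v : ℝ →L[ℝ] E) ∧
      ∀ᶠ t in 𝓝 0, f (c t) = b t := by
  set φ := extChartAt 𝓘(ℝ, E) p with hφ
  set ψ := extChartAt 𝓘(ℝ, F) (f p) with hψ
  set fh : E → F := fun y => ψ (f (φ.symm y)) with hfh
  have hfh1 : ContDiffAt ℝ ∞ fh (φ p) := by
    have := (contMDiffAt_iff.1 hf).2
    simpa [contDiffWithinAt_univ] using! this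
  have hmf : (mfderiv 𝓘(ℝ, E) 𝓘(ℝ, F) f p : E →L[ℝ] F) = fderiv ℝ fh (φ p) := by
    rw [(hf.mdifferentiableAt (by simp)).mfderiv]
    change fderivWithin ℝ fh (Set.range (id : E → E)) (φ p) = _
    rw [Set.range_id, fderivWithin_univ]
  have hst : HasStrictFDerivAt fh (fderiv ℝ fh (φ p)) (φ p) :=
    hfh1.hasStrictFDerivAt (by simp)
  have hb' := hasDerivAt_extChartAt_comp hb
  rw [hb0, ← hv, hmf] at hb'
  obtain ⟨c, hc0, hc, hcb⟩ := hst.exists_curve_lift (by rw [← hmf]; exact hs) hb'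
    (by simp [hfh, hφ, hψ, hb0])
  refine ⟨fun t => φ.symm (c t), by simp [hc0, hφ], hasMFDerivAt_extChartAt_symm_comp hc0 hc, ?_⟩
  have h1 : ContinuousAt (fun t => f (φ.symm (c t))) 0 := by
    have h2 : ContinuousAt (fun t => φ.symm (c t)) 0 :=
      (hasMFDerivAt_extChartAt_symm_comp hc0 hc).continuousAt
    refine ContinuousAt.comp (g := f) ?_ h2
    simp only [hc0, hφ, extChartAt_to_inv]
    exact hf.continuousAt
  have hsrc : ψ.source ∈ 𝓝 (f p) := extChartAt_source_mem_nhds _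
  -- The lift was made in charts. The chart `ψ` is injective only on its source, so both curves must
  -- stay there for small `t`.
  filter_upwards [hcb, h1.preimage_mem_nhds (by simpa [hc0, hφ] using hsrc),
    hb.continuousAt.preimage_mem_nhds (by simpa [hb0] using hsrc)] with t h3 h4 h5
  exact ψ.injOn h4 h5 h3

/-- Every tangent vector of a manifold is the velocity of a curve. -/
theorem exists_curve [IsManifold 𝓘(ℝ, E) 1 G] (p : G) (v : E) :
    ∃ c : ℝ → G, c 0 = p ∧
      HasMFDerivAt 𝓘(ℝ, ℝ) 𝓘(ℝ, E) c 0 (ContinuousLinearMap.toSpanSingleton ℝ v : ℝ →L[ℝ] E) := by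
  refine ⟨fun t => (extChartAt 𝓘(ℝ, E) p).symm (extChartAt 𝓘(ℝ, E) p p + t • v), by simp,
    hasMFDerivAt_extChartAt_symm_comp (by simp) ?_⟩
  simpa using ((hasDerivAt_id (0 : ℝ)).smul_const v).const_add (extChartAt 𝓘(ℝ, E) p p)

end CurveLifting

/-! ### Derivatives within subsets and velocities of curves -/

section TangentSubspace

variable {E : Type*} [NormedAddCommGroup E] [NormedSpace ℝ E]
  {H : Type*} [TopologicalSpace H] {I : ModelWithCorners ℝ E H}
  {M : Type*} [TopologicalSpace M] [ChartedSpace H M]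
  {E' : Type*} [NormedAddCommGroup E'] [NormedSpace ℝ E']
  {H' : Type*} [TopologicalSpace H'] {I' : ModelWithCorners ℝ E' H'}
  {N : Type*} [TopologicalSpace N] [ChartedSpace H' N]

/-- A derivative within `S` is determined on the tangent space of `S`. -/
theorem HasMFDerivWithinAt.apply_eq_of_mem_tangentSubspace {f : M → N} {S : Set M} {p : M}
    {D₁ D₂ : TangentSpace I p →L[ℝ] TangentSpace I' (f p)}
    (h₁ : HasMFDerivWithinAt I I' f S p D₁) (h₂ : HasMFDerivWithinAt I I' f S p D₂)
    {v : TangentSpace I p} (hv : v ∈ tangentSubspace I S p) : D₁ v = D₂ v := by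
  refine Submodule.span_induction (p := fun v _ => D₁ v = D₂ v) ?_ (by simp) ?_ ?_ hv
  -- On a generator both derivatives compute the velocity of `f ∘ c`, and derivatives on `ℝ` are
  -- unique.
  · rintro w ⟨c, hc0, hcS, hc⟩
    subst hc0
    have hc' := HasMFDerivAt.hasMFDerivWithinAt (s := c ⁻¹' S) hc
    have e₁ := HasMFDerivWithinAt.hasMFDerivAt
      (HasMFDerivWithinAt.comp (0 : ℝ) h₁ hc' subset_rfl) hcS
    have e₂ := HasMFDerivWithinAt.hasMFDerivAt
      (HasMFDerivWithinAt.comp (0 : ℝ) h₂ hc' subset_rfl) hcS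
    have e := DFunLike.congr_fun (hasMFDerivAt_unique e₁ e₂) (1 : ℝ)
    have h1 : (ContinuousLinearMap.toSpanSingleton ℝ (w : E) : ℝ →L[ℝ] E) 1 = w := one_smul ℝ (w : E)
    change D₁ ((ContinuousLinearMap.toSpanSingleton ℝ (w : E) : ℝ →L[ℝ] E) 1) =
      D₂ ((ContinuousLinearMap.toSpanSingleton ℝ (w : E) : ℝ →L[ℝ] E) 1) at e
    rwa [h1] at e
  · intro a b _ _ ha hb
    rw [map_add, map_add, ha, hb]
  · intro a b _ hb
    rw [map_smul, map_smul, hb]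

/-- In general these subsets lack unique differentiability, so `mfderivWithin` is only some chosen
derivative. Its values on tangent vectors are nevertheless forced, and any explicit derivative
computes them. -/
theorem mfderivWithin_apply_of_mem_tangentSubspace {f : M → N} {S : Set M} {p : M}
    {D : TangentSpace I p →L[ℝ] TangentSpace I' (f p)}
    (h : HasMFDerivWithinAt I I' f S p D)
    {v : TangentSpace I p} (hv : v ∈ tangentSubspace I S p) : mfderivWithin I I' f S p v = D v :=
  h.mdifferentiableWithinAt.hasMFDerivWithinAt.apply_eq_of_mem_tangentSubspace h hv

theorem mem_tangentSubspace_of_curve {S : Set M} {c : ℝ → M} {p : M} {v : E} (hc0 : c 0 = p)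
    (hc : HasMFDerivAt 𝓘(ℝ, ℝ) I c 0 (ContinuousLinearMap.toSpanSingleton ℝ v : ℝ →L[ℝ] E))
    (hS : ∀ᶠ t in 𝓝 0, c t ∈ S) : (show TangentSpace I p from v) ∈ tangentSubspace I S p :=
  Submodule.subset_span ⟨c, hc0, hS, hc⟩

theorem HasMFDerivAt.prodMk_toSpanSingleton {c : ℝ → M} {d : ℝ → N} {v : E} {w : E'}
    (hc : HasMFDerivAt 𝓘(ℝ, ℝ) I c 0 (ContinuousLinearMap.toSpanSingleton ℝ v : ℝ →L[ℝ] E))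
    (hd : HasMFDerivAt 𝓘(ℝ, ℝ) I' d 0 (ContinuousLinearMap.toSpanSingleton ℝ w : ℝ →L[ℝ] E')) :
    HasMFDerivAt 𝓘(ℝ, ℝ) (I.prod I') (fun t => (c t, d t)) 0
      (ContinuousLinearMap.toSpanSingleton ℝ (v, w) : ℝ →L[ℝ] E × E') := by
  have h := hc.prodMk hd
  have e : (ContinuousLinearMap.toSpanSingleton ℝ (v, w) : ℝ →L[ℝ] E × E') =
      (ContinuousLinearMap.toSpanSingleton ℝ v : ℝ →L[ℝ] E).prod
        (ContinuousLinearMap.toSpanSingleton ℝ w : ℝ →L[ℝ] E') := by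
    ext <;> simp
  rw [e]
  exact h

theorem HasMFDerivAt.comp_toSpanSingleton {f : M → N} {c : ℝ → M} {v : E}
    {D : TangentSpace I (c 0) →L[ℝ] TangentSpace I' (f (c 0))}
    (hf : HasMFDerivAt I I' f (c 0) D)
    (hc : HasMFDerivAt 𝓘(ℝ, ℝ) I c 0 (ContinuousLinearMap.toSpanSingleton ℝ v : ℝ →L[ℝ] E)) :
    HasMFDerivAt 𝓘(ℝ, ℝ) I' (fun t => f (c t)) 0
      (ContinuousLinearMap.toSpanSingleton ℝ ((D : E →L[ℝ] E') v) : ℝ →L[ℝ] E') := by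
  have h := HasMFDerivAt.comp (0 : ℝ) hf hc
  have e : (ContinuousLinearMap.toSpanSingleton ℝ ((D : E →L[ℝ] E') v) : ℝ →L[ℝ] E') =
      (D : E →L[ℝ] E') ∘L (ContinuousLinearMap.toSpanSingleton ℝ v : ℝ →L[ℝ] E) :=
    ContinuousLinearMap.ext fun t => (ContinuousLinearMap.map_smul (D : E →L[ℝ] E') t v).symm
  rw [e]
  exact h

theorem hasMFDerivAt_const_toSpanSingleton (p : M) :
    HasMFDerivAt 𝓘(ℝ, ℝ) I (fun _ : ℝ => p) 0
      (ContinuousLinearMap.toSpanSingleton ℝ (0 : E) : ℝ →L[ℝ] E) := by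
  have e : (ContinuousLinearMap.toSpanSingleton ℝ (0 : E) : ℝ →L[ℝ] E) = 0 := by ext; simp
  rw [e]
  exact hasMFDerivAt_const p (0 : ℝ)

end TangentSubspace

/-! ### Tangent spaces of source fibres, composable pairs and the prolongation -/

namespace LieGroupoid

variable {E F : Type*} [NormedAddCommGroup E] [NormedSpace ℝ E]
  [NormedAddCommGroup F] [NormedSpace ℝ F]
  {G Q : Type*} [TopologicalSpace G] [ChartedSpace E G]
  [TopologicalSpace Q] [ChartedSpace F Q]
  (Γ : LieGroupoid E F G Q)

/-- The derivative of the source map, on the model space. -/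
def srcDeriv (g : G) : E →L[ℝ] F := mfderiv 𝓘(ℝ, E) 𝓘(ℝ, F) Γ.src g

/-- The derivative of the target map, on the model space. -/
def tgtDeriv (g : G) : E →L[ℝ] F := mfderiv 𝓘(ℝ, E) 𝓘(ℝ, F) Γ.tgt g

theorem hasMFDerivAt_src (g : G) :
    HasMFDerivAt 𝓘(ℝ, E) 𝓘(ℝ, F) Γ.src g (Γ.srcDeriv g) :=
  (Γ.contMDiff_src.mdifferentiableAt (by simp)).hasMFDerivAt

theorem hasMFDerivAt_tgt (g : G) :
    HasMFDerivAt 𝓘(ℝ, E) 𝓘(ℝ, F) Γ.tgt g (Γ.tgtDeriv g) :=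
  (Γ.contMDiff_tgt.mdifferentiableAt (by simp)).hasMFDerivAt

theorem srcDeriv_surjective (g : G) : Function.Surjective (Γ.srcDeriv g) := Γ.submersion_src g

/-- The source map is constant on the fibre, so zero is also a derivative within it. -/
theorem srcDeriv_eq_zero_of_mem {q : Q} {x : G} {v : E}
    (hv : (show TangentSpace 𝓘(ℝ, E) x from v) ∈ tangentSubspace 𝓘(ℝ, E) (Γ.srcFibre q) x)
    (hx : Γ.src x = q) : Γ.srcDeriv x v = 0 := by
  have h₂ : HasMFDerivWithinAt 𝓘(ℝ, E) 𝓘(ℝ, F) Γ.src (Γ.srcFibre q) x (0 : E →L[ℝ] F) :=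
    (hasMFDerivWithinAt_const (Γ.src x) (Γ.srcFibre q) x).congr_of_eventuallyEq
      (Filter.eventually_of_mem self_mem_nhdsWithin fun y hy => hy.2.trans hx.symm) rfl
  exact (Γ.hasMFDerivAt_src x).hasMFDerivWithinAt.apply_eq_of_mem_tangentSubspace h₂ hv

/-- A constant curve in `Q` lifts along the submersion `Γ.src` with velocity `v`, and the lift stays
in the fibre. -/
theorem mem_tangentSubspace_srcFibre [FiniteDimensional ℝ E] [FiniteDimensional ℝ F]
    [IsManifold 𝓘(ℝ, E) ∞ G] {q : Q} {x : G} {v : E} (hx : Γ.src x = q)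
    (hv : Γ.srcDeriv x v = 0) :
    (show TangentSpace 𝓘(ℝ, E) x from v) ∈ tangentSubspace 𝓘(ℝ, E) (Γ.srcFibre q) x := by
  have : IsManifold 𝓘(ℝ, E) 1 G := IsManifold.of_le (n := ∞) (by simp)
  obtain ⟨c, hc0, hc, hcb⟩ := exists_curve_lift (b := fun _ => Γ.src x) (w := 0) (v := v)
    (Γ.contMDiff_src x) (Γ.submersion_src x) rfl (hasMFDerivAt_const_toSpanSingleton _) hv
  exact mem_tangentSubspace_of_curve hc0 hc (hcb.mono fun t ht => ⟨Γ.mem _, ht.trans hx⟩)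

/-- Take any curve in `G` with velocity `u`, push it to `Q` by the target map, and lift the result
along the source map with velocity `w`. -/
theorem mem_tangentSubspace_composable [FiniteDimensional ℝ E] [FiniteDimensional ℝ F]
    [IsManifold 𝓘(ℝ, E) ∞ G] {g h : G} (hgh : Γ.tgt g = Γ.src h) {u w : E}
    (huw : Γ.tgtDeriv g u = Γ.srcDeriv h w) :
    (show TangentSpace (𝓘(ℝ, E).prod 𝓘(ℝ, E)) (g, h) from (u, w)) ∈
      tangentSubspace (𝓘(ℝ, E).prod 𝓘(ℝ, E)) Γ.composable (g, h) := by
  have : IsManifold 𝓘(ℝ, E) 1 G := IsManifold.of_le (n := ∞) (by simp)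
  obtain ⟨a, ha0, ha⟩ := exists_curve g u
  have hb := HasMFDerivAt.comp_toSpanSingleton (Γ.hasMFDerivAt_tgt (a 0)) ha
  rw [ha0] at hb
  obtain ⟨c, hc0, hc, hcb⟩ := exists_curve_lift (v := w) (Γ.contMDiff_src h) (Γ.submersion_src h)
    (by simp [ha0, hgh]) hb huw.symm
  exact mem_tangentSubspace_of_curve (by simp [ha0, hc0]) (ha.prodMk_toSpanSingleton hc)
    (hcb.mono fun t ht => ⟨Γ.mem _, Γ.mem _, ht.symm⟩)

/-- The maps `tgt h` and `src r` agree on the prolongation, so both derivatives are derivatives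
within it of one map. -/
theorem tgtDeriv_eq_srcDeriv_of_mem {g h r : G} (hgr : Γ.tgt h = Γ.src r) {u v w : E}
    (hv : (show TangentSpace (𝓘(ℝ, E).prod (𝓘(ℝ, E).prod 𝓘(ℝ, E))) (g, h, r) from (u, v, w)) ∈
      tangentSubspace (𝓘(ℝ, E).prod (𝓘(ℝ, E).prod 𝓘(ℝ, E))) Γ.prolongation.arrows (g, h, r)) :
    Γ.tgtDeriv h v = Γ.srcDeriv r w := by
  have h₁ : HasMFDerivAt (𝓘(ℝ, E).prod (𝓘(ℝ, E).prod 𝓘(ℝ, E))) 𝓘(ℝ, F)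
      (fun p : G × G × G => Γ.tgt p.2.1) (g, h, r)
      (Γ.tgtDeriv h ∘L (ContinuousLinearMap.fst ℝ E E ∘L ContinuousLinearMap.snd ℝ E (E × E))) :=
    HasMFDerivAt.comp (g, h, r) (Γ.hasMFDerivAt_tgt h)
      (HasMFDerivAt.comp (g, h, r) (hasMFDerivAt_fst (h, r)) (hasMFDerivAt_snd (g, h, r)))
  have h₂ : HasMFDerivAt (𝓘(ℝ, E).prod (𝓘(ℝ, E).prod 𝓘(ℝ, E))) 𝓘(ℝ, F)
      (fun p : G × G × G => Γ.src p.2.2) (g, h, r)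
      (Γ.srcDeriv r ∘L (ContinuousLinearMap.snd ℝ E E ∘L ContinuousLinearMap.snd ℝ E (E × E))) :=
    HasMFDerivAt.comp (g, h, r) (Γ.hasMFDerivAt_src r)
      (HasMFDerivAt.comp (g, h, r) (hasMFDerivAt_snd (h, r)) (hasMFDerivAt_snd (g, h, r)))
  have h₃ : HasMFDerivWithinAt (𝓘(ℝ, E).prod (𝓘(ℝ, E).prod 𝓘(ℝ, E))) 𝓘(ℝ, F)
      (fun p : G × G × G => Γ.tgt p.2.1) Γ.prolongation.arrows (g, h, r)
      (Γ.srcDeriv r ∘L (ContinuousLinearMap.snd ℝ E E ∘L ContinuousLinearMap.snd ℝ E (E × E))) :=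
    h₂.hasMFDerivWithinAt.congr_of_eventuallyEq
      (Filter.eventually_of_mem self_mem_nhdsWithin fun y hy => hy.2) hgr
  exact h₁.hasMFDerivWithinAt.apply_eq_of_mem_tangentSubspace h₃ hv

end LieGroupoid

theorem tangentSubspace_mono {E : Type*} [NormedAddCommGroup E] [NormedSpace ℝ E]
    {H : Type*} [TopologicalSpace H] {I : ModelWithCorners ℝ E H}
    {M : Type*} [TopologicalSpace M] [ChartedSpace H M] {S T : Set M} (h : S ⊆ T) (p : M) :
    tangentSubspace I S p ≤ tangentSubspace I T p :=
  Submodule.span_mono fun _ ⟨c, hc0, hcS, hc⟩ => ⟨c, hc0, hcS.mono fun _ ht => h ht, hc⟩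

/-! ### Translations, and the algebroid of the prolongation -/

namespace LieGroupoid

variable {E F : Type*} [NormedAddCommGroup E] [NormedSpace ℝ E]
  [NormedAddCommGroup F] [NormedSpace ℝ F]
  {G Q : Type*} [TopologicalSpace G] [ChartedSpace E G]
  [TopologicalSpace Q] [ChartedSpace F Q]
  (Γ : LieGroupoid E F G Q)

/-- The multiplication extends to a smooth map near each composable pair. -/
theorem exists_smooth_extension_mul {g h : G} (hgh : Γ.tgt g = Γ.src h) :
    ∃ U : Set (G × G), IsOpen U ∧ (g, h) ∈ U ∧ ∃ f : G × G → G,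
      ContMDiffOn (𝓘(ℝ, E).prod 𝓘(ℝ, E)) 𝓘(ℝ, E) ∞ f U ∧
      ∀ a b, Γ.tgt a = Γ.src b → (a, b) ∈ U → f (a, b) = Γ.mul a b := by
  obtain ⟨U, hU, hgU, f, hf, hfm⟩ := Γ.smooth_mul ⟨(g, h), Γ.mem _, Γ.mem _, hgh⟩
  exact ⟨U, hU, hgU, f, hf, fun a b hab h => hfm ⟨(a, b), Γ.mem _, Γ.mem _, hab⟩ h⟩

theorem mdifferentiableWithinAt_mul_left (g : G) :
    MDifferentiableWithinAt 𝓘(ℝ, E) 𝓘(ℝ, E) (fun x => Γ.mul g x) (Γ.srcFibre (Γ.tgt g))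
      (Γ.one (Γ.tgt g)) := by
  obtain ⟨U, hU, hgU, f, hf, hfm⟩ :=
    Γ.exists_smooth_extension_mul (g := g) (h := Γ.one (Γ.tgt g)) (Γ.src_one _).symm
  have hfd : MDifferentiableAt (𝓘(ℝ, E).prod 𝓘(ℝ, E)) 𝓘(ℝ, E) f (g, Γ.one (Γ.tgt g)) :=
    (hf.contMDiffAt (hU.mem_nhds hgU)).mdifferentiableAt (by simp)
  have hcd : MDifferentiableAt 𝓘(ℝ, E) (𝓘(ℝ, E).prod 𝓘(ℝ, E)) (fun x => (g, x))
      (Γ.one (Γ.tgt g)) := mdifferentiableAt_const.prodMk mdifferentiableAt_id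
  refine (MDifferentiableAt.comp (Γ.one (Γ.tgt g)) hfd hcd).mdifferentiableWithinAt.congr_of_eventuallyEq
    ?_ ?_
  · have : ∀ᶠ x in 𝓝[Γ.srcFibre (Γ.tgt g)] (Γ.one (Γ.tgt g)), (g, x) ∈ U :=
      nhdsWithin_le_nhds (hcd.continuousAt.preimage_mem_nhds (hU.mem_nhds hgU))
    filter_upwards [this, self_mem_nhdsWithin] with x hx hx'
    exact (hfm _ _ hx'.2.symm hx).symm
  · exact (hfm _ _ (Γ.src_one _).symm hgU).symm

/-- A smooth extension `f` of the multiplication computes the derivative of `x ↦ x⁻¹ g`. -/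
theorem hasMFDerivWithinAt_inv_mul_right {U : Set (G × G)} (hU : IsOpen U) {f : G × G → G}
    (hf : ContMDiffOn (𝓘(ℝ, E).prod 𝓘(ℝ, E)) 𝓘(ℝ, E) ∞ f U)
    (hfm : ∀ a b, Γ.tgt a = Γ.src b → (a, b) ∈ U → f (a, b) = Γ.mul a b) {g : G}
    (hgU : (Γ.inv (Γ.one (Γ.src g)), g) ∈ U) :
    HasMFDerivWithinAt 𝓘(ℝ, E) 𝓘(ℝ, E) (fun x => Γ.mul (Γ.inv x) g) (Γ.srcFibre (Γ.src g))
      (Γ.one (Γ.src g))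
      ((mfderiv (𝓘(ℝ, E).prod 𝓘(ℝ, E)) 𝓘(ℝ, E) f (Γ.inv (Γ.one (Γ.src g)), g) : E × E →L[ℝ] E) ∘L
        (mfderiv 𝓘(ℝ, E) 𝓘(ℝ, E) Γ.inv (Γ.one (Γ.src g)) : E →L[ℝ] E).prod 0) := by
  have hfd : MDifferentiableAt (𝓘(ℝ, E).prod 𝓘(ℝ, E)) 𝓘(ℝ, E) f (Γ.inv (Γ.one (Γ.src g)), g) :=
    (hf.contMDiffAt (hU.mem_nhds hgU)).mdifferentiableAt (by simp)
  have hid : MDifferentiableAt 𝓘(ℝ, E) 𝓘(ℝ, E) Γ.inv (Γ.one (Γ.src g)) :=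
    (Γ.contMDiff_inv _).mdifferentiableAt (by simp)
  have hcd : HasMFDerivAt 𝓘(ℝ, E) (𝓘(ℝ, E).prod 𝓘(ℝ, E)) (fun x => (Γ.inv x, g))
      (Γ.one (Γ.src g)) ((mfderiv 𝓘(ℝ, E) 𝓘(ℝ, E) Γ.inv (Γ.one (Γ.src g)) : E →L[ℝ] E).prod 0) :=
    hid.hasMFDerivAt.prodMk (hasMFDerivAt_const g _)
  refine (HasMFDerivAt.comp (Γ.one (Γ.src g)) hfd.hasMFDerivAt hcd).hasMFDerivWithinAt.congr_of_eventuallyEq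
    ?_ ?_
  · have : ∀ᶠ x in 𝓝[Γ.srcFibre (Γ.src g)] (Γ.one (Γ.src g)), (Γ.inv x, g) ∈ U :=
      nhdsWithin_le_nhds (hcd.continuousAt.preimage_mem_nhds (hU.mem_nhds hgU))
    filter_upwards [this, self_mem_nhdsWithin] with x hx hx'
    exact (hfm _ _ ((Γ.tgt_inv _ (Γ.mem _)).trans hx'.2) hx).symm
  · exact (hfm _ _ ((Γ.tgt_inv _ (Γ.mem _)).trans (Γ.src_one _)) hgU).symm

/-- The derivative at the identity of the left translation by `g`, on the model space. -/
def leftDeriv (g : G) : E →L[ℝ] E :=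
  mfderivWithin 𝓘(ℝ, E) 𝓘(ℝ, E) (fun x => Γ.mul g x) (Γ.srcFibre (Γ.tgt g)) (Γ.one (Γ.tgt g))

/-- The derivative at the identity of the inversion followed by the right translation by `g`, on
the model space. -/
def rightDeriv (g : G) : E →L[ℝ] E :=
  mfderivWithin 𝓘(ℝ, E) 𝓘(ℝ, E) (fun x => Γ.mul (Γ.inv x) g) (Γ.srcFibre (Γ.src g))
    (Γ.one (Γ.src g))

theorem hasMFDerivWithinAt_leftDeriv {g : G} {q : Q} (hq : Γ.tgt g = q) :
    HasMFDerivWithinAt 𝓘(ℝ, E) 𝓘(ℝ, E) (fun x => Γ.mul g x) (Γ.srcFibre q) (Γ.one q)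
      (Γ.leftDeriv g) := by
  subst hq
  exact (Γ.mdifferentiableWithinAt_mul_left g).hasMFDerivWithinAt

theorem hasMFDerivWithinAt_rightDeriv {g : G} {q : Q} (hq : Γ.src g = q) :
    HasMFDerivWithinAt 𝓘(ℝ, E) 𝓘(ℝ, E) (fun x => Γ.mul (Γ.inv x) g) (Γ.srcFibre q) (Γ.one q)
      (Γ.rightDeriv g) := by
  subst hq
  obtain ⟨U, hU, hgU, f, hf, hfm⟩ :=
    Γ.exists_smooth_extension_mul (g := Γ.inv (Γ.one (Γ.src g))) (h := g)
      ((Γ.tgt_inv _ (Γ.mem _)).trans (Γ.src_one _))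
  exact (Γ.hasMFDerivWithinAt_inv_mul_right hU hf hfm hgU).mdifferentiableWithinAt.hasMFDerivWithinAt

/-- Left multiplication in the prolongation fixes the first entry, left-translates the middle one
and keeps the last. -/
theorem prolongation_leftInvariant_apply {g h r : G} (hp : (g, h, r) ∈ Γ.prolongation.arrows)
    (z : Γ.prolongation.algebroidFibre (𝓘(ℝ, E).prod (𝓘(ℝ, E).prod 𝓘(ℝ, E))) r) :
    ((Γ.prolongation.leftInvariant (𝓘(ℝ, E).prod (𝓘(ℝ, E).prod 𝓘(ℝ, E))) (g, h, r) hp z :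
      TangentSpace (𝓘(ℝ, E).prod (𝓘(ℝ, E).prod 𝓘(ℝ, E))) (g, h, r)) : E × E × E) =
    ((0 : E), Γ.leftDeriv h (z.1 : E × E × E).2.1, (z.1 : E × E × E).2.2) := by
  have hpr : HasMFDerivAt (𝓘(ℝ, E).prod (𝓘(ℝ, E).prod 𝓘(ℝ, E))) 𝓘(ℝ, E)
      (fun p : G × G × G => p.2.1) (Γ.prolongation.one r)
      (ContinuousLinearMap.fst ℝ E E ∘L ContinuousLinearMap.snd ℝ E (E × E)) :=
    HasMFDerivAt.comp (Γ.prolongation.one r) (hasMFDerivAt_fst (Γ.one (Γ.src r), r))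
      (hasMFDerivAt_snd (Γ.prolongation.one r))
  have hpr' : HasMFDerivAt (𝓘(ℝ, E).prod (𝓘(ℝ, E).prod 𝓘(ℝ, E))) 𝓘(ℝ, E)
      (fun p : G × G × G => p.2.2) (Γ.prolongation.one r)
      (ContinuousLinearMap.snd ℝ E E ∘L ContinuousLinearMap.snd ℝ E (E × E)) :=
    HasMFDerivAt.comp (Γ.prolongation.one r) (hasMFDerivAt_snd (Γ.one (Γ.src r), r))
      (hasMFDerivAt_snd (Γ.prolongation.one r))
  have h₁ : HasMFDerivWithinAt (𝓘(ℝ, E).prod (𝓘(ℝ, E).prod 𝓘(ℝ, E))) 𝓘(ℝ, E)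
      (fun p : G × G × G => Γ.mul h p.2.1) (Γ.prolongation.srcFibre r) (Γ.prolongation.one r)
      (Γ.leftDeriv h ∘L (ContinuousLinearMap.fst ℝ E E ∘L ContinuousLinearMap.snd ℝ E (E × E))) :=
    HasMFDerivWithinAt.comp (Γ.prolongation.one r) (Γ.hasMFDerivWithinAt_leftDeriv hp.2)
      hpr.hasMFDerivWithinAt (fun x hx => ⟨Γ.mem _, by rw [← hx.1.1]; exact congrArg Γ.src hx.2⟩)
  have h₂ : HasMFDerivWithinAt (𝓘(ℝ, E).prod (𝓘(ℝ, E).prod 𝓘(ℝ, E)))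
      (𝓘(ℝ, E).prod (𝓘(ℝ, E).prod 𝓘(ℝ, E)))
      (fun p : G × G × G => Γ.prolongation.mul (g, h, r) p) (Γ.prolongation.srcFibre r)
      (Γ.prolongation.one r) _ :=
    (hasMFDerivWithinAt_const (I' := 𝓘(ℝ, E)) g (Γ.prolongation.srcFibre r)
      (Γ.prolongation.one r)).prodMk (h₁.prodMk hpr'.hasMFDerivWithinAt)
  exact mfderivWithin_apply_of_mem_tangentSubspace h₂ z.2

/-- Inversion brings the last entry to the front, and right multiplication then fixes the new last
entry. The overall sign belongs to the right-invariant field, since `rightDeriv` is unsigned; it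
produces the minus sign before `Y` in (1). -/
theorem prolongation_rightInvariant_apply {g h r : G} (hp : (g, h, r) ∈ Γ.prolongation.arrows)
    (z : Γ.prolongation.algebroidFibre (𝓘(ℝ, E).prod (𝓘(ℝ, E).prod 𝓘(ℝ, E))) g) :
    ((Γ.prolongation.rightInvariant (𝓘(ℝ, E).prod (𝓘(ℝ, E).prod 𝓘(ℝ, E))) (g, h, r) hp z :
      TangentSpace (𝓘(ℝ, E).prod (𝓘(ℝ, E).prod 𝓘(ℝ, E))) (g, h, r)) : E × E × E) =
    -((z.1 : E × E × E).2.2, Γ.rightDeriv h (z.1 : E × E × E).2.1, (0 : E)) := by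
  have hpr : HasMFDerivAt (𝓘(ℝ, E).prod (𝓘(ℝ, E).prod 𝓘(ℝ, E))) 𝓘(ℝ, E)
      (fun p : G × G × G => p.2.1) (Γ.prolongation.one g)
      (ContinuousLinearMap.fst ℝ E E ∘L ContinuousLinearMap.snd ℝ E (E × E)) :=
    HasMFDerivAt.comp (Γ.prolongation.one g) (hasMFDerivAt_fst (Γ.one (Γ.src g), g))
      (hasMFDerivAt_snd (Γ.prolongation.one g))
  have hpr' : HasMFDerivAt (𝓘(ℝ, E).prod (𝓘(ℝ, E).prod 𝓘(ℝ, E))) 𝓘(ℝ, E)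
      (fun p : G × G × G => p.2.2) (Γ.prolongation.one g)
      (ContinuousLinearMap.snd ℝ E E ∘L ContinuousLinearMap.snd ℝ E (E × E)) :=
    HasMFDerivAt.comp (Γ.prolongation.one g) (hasMFDerivAt_snd (Γ.one (Γ.src g), g))
      (hasMFDerivAt_snd (Γ.prolongation.one g))
  have h₁ : HasMFDerivWithinAt (𝓘(ℝ, E).prod (𝓘(ℝ, E).prod 𝓘(ℝ, E))) 𝓘(ℝ, E)
      (fun p : G × G × G => Γ.mul (Γ.inv p.2.1) h) (Γ.prolongation.srcFibre g)
      (Γ.prolongation.one g)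
      (Γ.rightDeriv h ∘L (ContinuousLinearMap.fst ℝ E E ∘L ContinuousLinearMap.snd ℝ E (E × E))) :=
    HasMFDerivWithinAt.comp (g := fun x => Γ.mul (Γ.inv x) h) (f := fun p : G × G × G => p.2.1)
      (u := Γ.srcFibre (Γ.src g)) (Γ.prolongation.one g) (Γ.hasMFDerivWithinAt_rightDeriv hp.1.symm)
      hpr.hasMFDerivWithinAt (fun x hx => ⟨Γ.mem _, by rw [← hx.1.1]; exact congrArg Γ.src hx.2⟩)
  have h₂ : HasMFDerivWithinAt (𝓘(ℝ, E).prod (𝓘(ℝ, E).prod 𝓘(ℝ, E)))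
      (𝓘(ℝ, E).prod (𝓘(ℝ, E).prod 𝓘(ℝ, E)))
      (fun p : G × G × G => Γ.prolongation.mul (Γ.prolongation.inv p) (g, h, r))
      (Γ.prolongation.srcFibre g) (Γ.prolongation.one g) _ :=
    hpr'.hasMFDerivWithinAt.prodMk (h₁.prodMk (hasMFDerivWithinAt_const (I' := 𝓘(ℝ, E)) r
      (Γ.prolongation.srcFibre g) (Γ.prolongation.one g)))
  exact congrArg (fun v : E × E × E => -v) (mfderivWithin_apply_of_mem_tangentSubspace h₂ z.2)

/-- The conditions are the linearised equations of the source fibre. They suffice by lifting twice: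
a constant curve to `c` with velocity `v`, then `tgt ∘ c` to a curve with velocity `w`. -/
theorem mem_prolongation_algebroidFibre_iff [FiniteDimensional ℝ E] [FiniteDimensional ℝ F]
    [IsManifold 𝓘(ℝ, E) ∞ G] {g : G} {u v w : E} :
    (show TangentSpace (𝓘(ℝ, E).prod (𝓘(ℝ, E).prod 𝓘(ℝ, E))) (Γ.prolongation.one g)
      from (u, v, w)) ∈ Γ.prolongation.algebroidFibre (𝓘(ℝ, E).prod (𝓘(ℝ, E).prod 𝓘(ℝ, E))) g ↔
    u = 0 ∧ Γ.srcDeriv (Γ.one (Γ.src g)) v = 0 ∧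
      Γ.tgtDeriv (Γ.one (Γ.src g)) v = Γ.srcDeriv g w := by
  have : IsManifold 𝓘(ℝ, E) 1 G := IsManifold.of_le (n := ∞) (by simp)
  constructor
  · intro hz
    refine ⟨?_, ?_, Γ.tgtDeriv_eq_srcDeriv_of_mem (Γ.tgt_one _)
      (tangentSubspace_mono (fun x hx => hx.1) _ hz)⟩
    · have h₂ : HasMFDerivWithinAt (𝓘(ℝ, E).prod (𝓘(ℝ, E).prod 𝓘(ℝ, E))) 𝓘(ℝ, E)
          (Prod.fst : G × G × G → G) (Γ.prolongation.srcFibre g) (Γ.prolongation.one g)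
          (0 : E × E × E →L[ℝ] E) :=
        (hasMFDerivWithinAt_const g _ _).congr_of_eventuallyEq
          (Filter.eventually_of_mem self_mem_nhdsWithin fun y hy => hy.2) rfl
      exact (hasMFDerivAt_fst (Γ.prolongation.one g)).hasMFDerivWithinAt
        |>.apply_eq_of_mem_tangentSubspace h₂ hz
    · have h₁ : HasMFDerivAt (𝓘(ℝ, E).prod (𝓘(ℝ, E).prod 𝓘(ℝ, E))) 𝓘(ℝ, F)
          (fun p : G × G × G => Γ.src p.2.1) (Γ.prolongation.one g)
          (Γ.srcDeriv (Γ.one (Γ.src g)) ∘L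
            (ContinuousLinearMap.fst ℝ E E ∘L ContinuousLinearMap.snd ℝ E (E × E))) :=
        HasMFDerivAt.comp (Γ.prolongation.one g) (Γ.hasMFDerivAt_src _)
          (HasMFDerivAt.comp (Γ.prolongation.one g) (hasMFDerivAt_fst (Γ.one (Γ.src g), g))
            (hasMFDerivAt_snd (Γ.prolongation.one g)))
      have h₂ : HasMFDerivWithinAt (𝓘(ℝ, E).prod (𝓘(ℝ, E).prod 𝓘(ℝ, E))) 𝓘(ℝ, F)
          (fun p : G × G × G => Γ.src p.2.1) (Γ.prolongation.srcFibre g) (Γ.prolongation.one g)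
          (0 : E × E × E →L[ℝ] F) :=
        (hasMFDerivWithinAt_const (Γ.src g) _ _).congr_of_eventuallyEq
          (Filter.eventually_of_mem self_mem_nhdsWithin fun y hy =>
            hy.1.1.symm.trans (congrArg Γ.src hy.2)) (Γ.src_one _)
      exact h₁.hasMFDerivWithinAt.apply_eq_of_mem_tangentSubspace h₂ hz
  · rintro ⟨rfl, hv, hw⟩
    obtain ⟨c, hc0, hc, hcb⟩ := exists_curve_lift (b := fun _ => Γ.src g) (w := 0) (v := v)
      (Γ.contMDiff_src (Γ.one (Γ.src g))) (Γ.submersion_src _) (Γ.src_one _).symm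
      (hasMFDerivAt_const_toSpanSingleton _) hv
    have hb := HasMFDerivAt.comp_toSpanSingleton (Γ.hasMFDerivAt_tgt (c 0)) hc
    rw [hc0] at hb
    obtain ⟨d, hd0, hd, hdb⟩ := exists_curve_lift (v := w) (Γ.contMDiff_src g) (Γ.submersion_src g)
      (by simp [hc0, Γ.tgt_one]) hb hw.symm
    refine mem_tangentSubspace_of_curve (c := fun t => (g, c t, d t)) ?_
      ((hasMFDerivAt_const_toSpanSingleton g).prodMk_toSpanSingleton
        (hc.prodMk_toSpanSingleton hd)) ?_
    · simp [hc0, hd0, prolongation]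
    · filter_upwards [hcb, hdb] with t h₁ h₂
      exact ⟨⟨h₁.symm, h₂.symm⟩, rfl⟩

end LieGroupoid

/-! ### Extending vertical vectors to vertical fields -/

section VerticalFields

variable {E F : Type*} [NormedAddCommGroup E] [NormedSpace ℝ E]
  [NormedAddCommGroup F] [NormedSpace ℝ F]

/-- A linear right inverse of the derivative of `f` at `y₀` yields a field in the kernel of the
derivative, smooth near `y₀`, with given value in the kernel at `y₀`. -/
theorem ContDiffOn.exists_kernel_field [FiniteDimensional ℝ F] {f : E → F} {T : Set E}
    (hT : IsOpen T)
    (hf : ContDiffOn ℝ ∞ f T) {y₀ : E} (hy₀ : y₀ ∈ T) (hs : Function.Surjective (fderiv ℝ f y₀))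
    {v : E} (hv : fderiv ℝ f y₀ v = 0) :
    ∃ O : Set E, IsOpen O ∧ y₀ ∈ O ∧ O ⊆ T ∧ ∃ W : E → E, ContDiffOn ℝ ∞ W O ∧ W y₀ = v ∧
      ∀ y ∈ O, fderiv ℝ f y (W y) = 0 := by
  obtain ⟨R, hR⟩ := (fderiv ℝ f y₀).exists_rightInverse_of_surjective (LinearMap.range_eq_top.2 hs)
  have hD : ContDiffOn ℝ ∞ (fderiv ℝ f) T := hf.fderiv_of_isOpen hT (by simp)
  -- `N` is the identity at `y₀`, hence invertible nearby, so `R ∘ N⁻¹` is a smooth family of right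
  -- inverses of the derivative.
  set N : E → F →L[ℝ] F := fun y => fderiv ℝ f y ∘L R with hN
  have hNs : ContDiffOn ℝ ∞ N T := hD.clm_comp contDiffOn_const
  have hO : IsOpen (T ∩ N ⁻¹' {A | A.IsInvertible}) := by
    refine hNs.continuousOn.isOpen_inter_preimage hT ?_
    exact ContinuousLinearEquiv.isOpen
  -- Subtracting from the constant field `v` its image under `R ∘ N⁻¹ ∘ Df` projects it to the
  -- kernel. At `y₀` nothing is subtracted, because `v` lies in the kernel there.
  refine ⟨_, hO, ⟨hy₀, ?_⟩, Set.inter_subset_left,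
    fun y => v - R ((N y).inverse (fderiv ℝ f y v)), ?_, ?_, ?_⟩
  · refine ⟨ContinuousLinearEquiv.refl ℝ F, ?_⟩
    simp only [hN, hR]
    rfl
  · have hi : ContDiffOn ℝ ∞ (fun y => (N y).inverse) (T ∩ N ⁻¹' {A | A.IsInvertible}) := by
      rintro y ⟨hyT, hyN⟩
      exact (ContDiffAt.comp y (hyN.contDiffAt_map_inverse (n := ∞))
        (hNs.contDiffAt (hT.mem_nhds hyT))).contDiffWithinAt
    exact contDiffOn_const.sub (R.contDiff.comp_contDiffOn
      (hi.clm_apply ((hD.mono Set.inter_subset_left).clm_apply contDiffOn_const)))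
  · simp [hv]
  · rintro y ⟨-, e, he⟩
    have h1 : ∀ w, fderiv ℝ f y (R ((N y).inverse w)) = w := fun w => by
      change N y ((N y).inverse w) = w
      rw [← he, ContinuousLinearMap.inverse_equiv]
      simp
    rw [map_sub, h1, sub_self]

variable [FiniteDimensional ℝ E] [FiniteDimensional ℝ F]
  {G Q : Type*} [TopologicalSpace G] [ChartedSpace E G]
  [TopologicalSpace Q] [ChartedSpace F Q] [IsManifold 𝓘(ℝ, E) ∞ G] [IsManifold 𝓘(ℝ, F) ∞ Q]

/-- The linear-space construction is applied to the chart expression of `f` and the field is pulled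
back. Charts have invertible derivatives, so they preserve and reflect verticality. -/
theorem exists_vertical_field_on {f : G → Q} (hf : ContMDiff 𝓘(ℝ, E) 𝓘(ℝ, F) ∞ f) (p : G)
    (hs : Function.Surjective (mfderiv 𝓘(ℝ, E) 𝓘(ℝ, F) f p)) {v : TangentSpace 𝓘(ℝ, E) p}
    (hv : mfderiv 𝓘(ℝ, E) 𝓘(ℝ, F) f p v = 0) :
    ∃ u : Set G, IsOpen u ∧ p ∈ u ∧ ∃ V : ∀ x : G, TangentSpace 𝓘(ℝ, E) x,
      ContMDiffOn 𝓘(ℝ, E) 𝓘(ℝ, E).tangent ∞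
        (fun x => (⟨x, V x⟩ : TangentBundle 𝓘(ℝ, E) G)) u ∧
      V p = v ∧ ∀ x ∈ u, mfderiv 𝓘(ℝ, E) 𝓘(ℝ, F) f x (V x) = 0 := by
  have : IsManifold 𝓘(ℝ, E) 1 G := IsManifold.of_le (n := ∞) (by simp)
  have : IsManifold 𝓘(ℝ, F) 1 Q := IsManifold.of_le (n := ∞) (by simp)
  set φ := extChartAt 𝓘(ℝ, E) p with hφ
  set ψ := extChartAt 𝓘(ℝ, F) (f p) with hψ
  set fh : E → F := fun y => ψ (f (φ.symm y)) with hfh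
  set u₀ : Set G := φ.source ∩ f ⁻¹' ψ.source with hu₀
  have hu₀o : IsOpen u₀ :=
    (isOpen_extChartAt_source p).inter ((isOpen_extChartAt_source (f p)).preimage hf.continuous)
  set T : Set E := φ.target ∩ φ.symm ⁻¹' u₀ with hT
  have hTo : IsOpen T := (continuousOn_extChartAt_symm p).isOpen_inter_preimage
    (isOpen_extChartAt_target p) hu₀o
  have hpu₀ : p ∈ u₀ := ⟨mem_extChartAt_source p, mem_extChartAt_source (f p)⟩
  have hmem : ∀ x ∈ u₀, φ x ∈ T := fun x hx =>
    ⟨φ.map_source hx.1, by simpa only [Set.mem_preimage, φ.left_inv hx.1] using hx⟩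
  have hfhs : ContDiffOn ℝ ∞ fh T := by
    rw [← contMDiffOn_iff_contDiffOn]
    refine (contMDiffOn_extChartAt (x := f p)).comp (t := (chartAt F (f p)).source)
      (hf.comp_contMDiffOn ((contMDiffOn_extChartAt_symm p).mono Set.inter_subset_left)) ?_
    intro y hy
    have := hy.2.2
    rwa [hψ, extChartAt_source] at this
  -- the chart expression of the derivative
  have hchart : ∀ x ∈ u₀, ∀ w : TangentSpace 𝓘(ℝ, E) x,
      fderiv ℝ fh (φ x) (mfderiv 𝓘(ℝ, E) 𝓘(ℝ, E) φ x w) =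
        mfderiv 𝓘(ℝ, F) 𝓘(ℝ, F) ψ (f x) (mfderiv 𝓘(ℝ, E) 𝓘(ℝ, F) f x w) := by
    intro x hx w
    have hφx : MDifferentiableAt 𝓘(ℝ, E) 𝓘(ℝ, E) φ x :=
      mdifferentiableAt_extChartAt (by simpa [hφ] using hx.1)
    have hψx : MDifferentiableAt 𝓘(ℝ, F) 𝓘(ℝ, F) ψ (f x) :=
      mdifferentiableAt_extChartAt (by simpa [hψ] using hx.2)
    have hfx : MDifferentiableAt 𝓘(ℝ, E) 𝓘(ℝ, F) f x := hf.mdifferentiableAt (by simp)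
    have hfhx : HasMFDerivAt 𝓘(ℝ, E) 𝓘(ℝ, F) fh (φ x) (fderiv ℝ fh (φ x)) :=
      ((hfhs.contDiffAt (hTo.mem_nhds (hmem x hx))).differentiableAt
        (by simp)).hasFDerivAt.hasMFDerivAt
    have e₁ := HasMFDerivAt.comp x hfhx hφx.hasMFDerivAt
    have e₂ := HasMFDerivAt.comp x hψx.hasMFDerivAt hfx.hasMFDerivAt
    have e : (fh ∘ φ) =ᶠ[𝓝 x] (ψ ∘ f) := by
      filter_upwards [hu₀o.mem_nhds hx] with y hy
      simp only [Function.comp, hfh, φ.left_inv hy.1]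
    exact DFunLike.congr_fun (hasMFDerivAt_unique e₁ (e₂.congr_of_eventuallyEq e)) w
  have hψinv : ∀ x ∈ u₀, (mfderiv 𝓘(ℝ, F) 𝓘(ℝ, F) ψ (f x)).IsInvertible := fun x hx =>
    isInvertible_mfderiv_extChartAt hx.2
  have hφinv : ∀ x ∈ u₀, (mfderiv 𝓘(ℝ, E) 𝓘(ℝ, E) φ x).IsInvertible := fun x hx =>
    isInvertible_mfderiv_extChartAt hx.1
  have hs' : Function.Surjective (fderiv ℝ fh (φ p)) := by
    intro y
    obtain ⟨z, hz⟩ := (hψinv p hpu₀).bijective.2 y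
    obtain ⟨w, hw⟩ := hs z
    exact ⟨mfderiv 𝓘(ℝ, E) 𝓘(ℝ, E) φ p w, by rw [hchart p hpu₀, hw]; exact hz⟩
  obtain ⟨O, hO, hpO, hOT, W, hW, hWp, hWv⟩ := hfhs.exists_kernel_field hTo (hmem p hpu₀) hs'
    (v := mfderiv 𝓘(ℝ, E) 𝓘(ℝ, E) φ p v) (by rw [hchart p hpu₀, hv]; exact map_zero _)
  have hVa : ∀ x, VectorField.mpullback 𝓘(ℝ, E) 𝓘(ℝ, E) φ W x =
    (mfderiv 𝓘(ℝ, E) 𝓘(ℝ, E) φ x).inverse (W (φ x)) := fun x => rfl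
  refine ⟨u₀ ∩ φ ⁻¹' O, ?_, ⟨hpu₀, hpO⟩, VectorField.mpullback 𝓘(ℝ, E) 𝓘(ℝ, E) φ W, ?_, ?_, ?_⟩
  · exact ((continuousOn_extChartAt p).mono Set.inter_subset_left).isOpen_inter_preimage hu₀o hO
  · rintro x ⟨hx, hxO⟩
    refine (ContMDiffAt.mpullback_vectorField_preimage (n := ∞) (V := W) ?_ ?_ (hφinv x hx)
      (by simp)).contMDiffWithinAt
    · exact contMDiffAt_vectorSpace_iff_contDiffAt.2 (hW.contDiffAt (hO.mem_nhds hxO))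
    · exact contMDiffAt_extChartAt' (by simpa [hφ] using hx.1)
  · rw [hVa, hWp]
    obtain ⟨e, he⟩ := hφinv p hpu₀
    rw [← he, ContinuousLinearMap.inverse_equiv]
    exact e.symm_apply_apply v
  · rintro x ⟨hx, hxO⟩
    apply (hψinv x hx).bijective.1
    rw [← hchart x hx, hVa]
    have : (mfderiv 𝓘(ℝ, E) 𝓘(ℝ, E) φ x) ((mfderiv 𝓘(ℝ, E) 𝓘(ℝ, E) φ x).inverse (W (φ x))) =
        W (φ x) := by
      obtain ⟨e, he⟩ := hφinv x hx
      rw [← he, ContinuousLinearMap.inverse_equiv]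
      exact e.apply_symm_apply _
    rw [this]
    exact (hWv _ hxO).trans (map_zero _).symm

/-- A vertical vector of a submersion extends to a global smooth vertical vector field. -/
theorem exists_vertical_field [T2Space G] {f : G → Q} (hf : ContMDiff 𝓘(ℝ, E) 𝓘(ℝ, F) ∞ f) (p : G)
    (hs : Function.Surjective (mfderiv 𝓘(ℝ, E) 𝓘(ℝ, F) f p)) {v : TangentSpace 𝓘(ℝ, E) p}
    (hv : mfderiv 𝓘(ℝ, E) 𝓘(ℝ, F) f p v = 0) :
    ∃ V : ∀ x : G, TangentSpace 𝓘(ℝ, E) x,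
      ContMDiff 𝓘(ℝ, E) 𝓘(ℝ, E).tangent ∞
        (fun x => (⟨x, V x⟩ : TangentBundle 𝓘(ℝ, E) G)) ∧
      V p = v ∧ ∀ x, mfderiv 𝓘(ℝ, E) 𝓘(ℝ, F) f x (V x) = 0 := by
  obtain ⟨u, hu, hpu, V, hV, hVp, hVv⟩ := exists_vertical_field_on hf p hs hv
  -- The kernel is a linear condition, so multiplication by a bump function preserves it and extends
  -- the field by zero outside `u`. The value at `p` survives because `χ` is `1` there.
  obtain ⟨χ, -, hχ⟩ := (SmoothBumpFunction.nhds_basis_tsupport (I := 𝓘(ℝ, E)) p).mem_iff.1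
    (hu.mem_nhds hpu)
  refine ⟨(χ : G → ℝ) • V, ContMDiffOn.smul_section_of_tsupport χ.contMDiff.contMDiffOn hu hχ hV,
    ?_, fun x => ?_⟩
  · simp [hVp]
  · by_cases hx : x ∈ u
    · rw [Pi.smul_apply', map_smul, hVv x hx, smul_zero]
    · rw [Pi.smul_apply', image_eq_zero_of_notMem_tsupport fun h => hx (hχ h), zero_smul, map_zero]

end VerticalFields

/-- All tangent spaces are the model space `E`, so fibre vectors can be compared over base points
that are equal only propositionally. -/
theorem TangentBundle.mk_eq_mk_iff {E : Type*} [NormedAddCommGroup E] [NormedSpace ℝ E]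
    {G : Type*} [TopologicalSpace G] [ChartedSpace E G] {x y : G} {v w : E} (h : x = y) :
    (⟨x, v⟩ : TangentBundle 𝓘(ℝ, E) G) = ⟨y, w⟩ ↔ v = w := by
  subst h
  constructor
  · intro e
    injection e
  · rintro rfl
    rfl

/-! ### Global sections of the algebroid of the prolongation -/

namespace LieGroupoid

variable {E F : Type*} [NormedAddCommGroup E] [NormedSpace ℝ E]
  [NormedAddCommGroup F] [NormedSpace ℝ F]
  {G Q : Type*} [TopologicalSpace G] [ChartedSpace E G]
  [TopologicalSpace Q] [ChartedSpace F Q]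
  (Γ : LieGroupoid E F G Q)

/-- Differentiate `src (x⁻¹ g) = tgt x` along the source fibre. This gives the transported field
exactly the projection required of `Y` in a section `(X, Y)`. -/
theorem srcDeriv_rightDeriv {g : G} {v : E}
    (hv : (show TangentSpace 𝓘(ℝ, E) (Γ.one (Γ.src g)) from v) ∈
      Γ.algebroidFibre 𝓘(ℝ, E) (Γ.src g)) :
    Γ.srcDeriv g (Γ.rightDeriv g v) = Γ.tgtDeriv (Γ.one (Γ.src g)) v := by
  have e : Γ.mul (Γ.inv (Γ.one (Γ.src g))) g = g := by rw [Γ.inv_one, Γ.one_mul _ (Γ.mem _)]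
  have hs : HasMFDerivAt 𝓘(ℝ, E) 𝓘(ℝ, F) Γ.src (Γ.mul (Γ.inv (Γ.one (Γ.src g))) g)
      (Γ.srcDeriv g) := by
    rw [e]; exact Γ.hasMFDerivAt_src g
  have h₁ : HasMFDerivWithinAt 𝓘(ℝ, E) 𝓘(ℝ, F) (fun x => Γ.src (Γ.mul (Γ.inv x) g))
      (Γ.srcFibre (Γ.src g)) (Γ.one (Γ.src g)) (Γ.srcDeriv g ∘L Γ.rightDeriv g) :=
    HasMFDerivAt.comp_hasMFDerivWithinAt (Γ.one (Γ.src g)) hs (Γ.hasMFDerivWithinAt_rightDeriv rfl)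
  have ht : ∀ x ∈ Γ.srcFibre (Γ.src g), Γ.src (Γ.mul (Γ.inv x) g) = Γ.tgt x := fun x hx => by
    rw [Γ.src_mul _ (Γ.mem _) _ (Γ.mem _) ((Γ.tgt_inv _ (Γ.mem _)).trans hx.2),
      Γ.src_inv _ (Γ.mem _)]
  have h₂ : HasMFDerivWithinAt 𝓘(ℝ, E) 𝓘(ℝ, F) (fun x => Γ.src (Γ.mul (Γ.inv x) g))
      (Γ.srcFibre (Γ.src g)) (Γ.one (Γ.src g)) (Γ.tgtDeriv (Γ.one (Γ.src g))) :=
    (Γ.hasMFDerivAt_tgt _).hasMFDerivWithinAt.congr_of_eventuallyEq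
      (Filter.eventually_of_mem self_mem_nhdsWithin ht) (ht _ ⟨Γ.mem _, Γ.src_one _⟩)
  exact h₁.apply_eq_of_mem_tangentSubspace h₂ hv

section Smooth

variable [IsManifold 𝓘(ℝ, E) ∞ G]

/-- The right-invariant vector field of a section of the Lie algebroid is smooth. -/
theorem AlgebroidSection.contMDiff_rightDeriv [IsManifold 𝓘(ℝ, F) ∞ Q] {Γ : LieGroupoid E F G Q}
    (X : Γ.AlgebroidSection) :
    ContMDiff 𝓘(ℝ, E) 𝓘(ℝ, E).tangent ∞ (fun g => (⟨g, (Γ.rightDeriv g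
      (show E from (X.toFun (Γ.src g)).1) : E)⟩ : TangentBundle 𝓘(ℝ, E) G)) := by
  have : IsManifold 𝓘(ℝ, E) 1 G := IsManifold.of_le (n := ∞) (by simp)
  intro g₀
  obtain ⟨U, hU, hgU, f, hf, hfm⟩ :=
    Γ.exists_smooth_extension_mul (g := Γ.inv (Γ.one (Γ.src g₀))) (h := g₀)
      ((Γ.tgt_inv _ (Γ.mem _)).trans (Γ.src_one _))
  have s₁ : ContMDiff 𝓘(ℝ, E) 𝓘(ℝ, E).tangent ∞
      (fun g => (⟨Γ.one (Γ.src g), (X.toFun (Γ.src g)).1⟩ : TangentBundle 𝓘(ℝ, E) G)) :=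
    X.contMDiff.comp Γ.contMDiff_src
  have s₂ : ContMDiff 𝓘(ℝ, E) 𝓘(ℝ, E).tangent ∞
      (fun g => tangentMap 𝓘(ℝ, E) 𝓘(ℝ, E) Γ.inv
        (⟨Γ.one (Γ.src g), (X.toFun (Γ.src g)).1⟩ : TangentBundle 𝓘(ℝ, E) G)) :=
    (Γ.contMDiff_inv.contMDiff_tangentMap (m := ∞) (by simp)).comp s₁
  -- Near `g₀` the field is `Tf` applied to `(Ti X, 0)`, for a smooth extension `f` of the
  -- multiplication. This exhibits it as a composite of smooth maps.
  have s₃ : ContMDiff 𝓘(ℝ, E) (𝓘(ℝ, E).prod 𝓘(ℝ, E)).tangent ∞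
      (fun g => (equivTangentBundleProd 𝓘(ℝ, E) G 𝓘(ℝ, E) G).symm
        (tangentMap 𝓘(ℝ, E) 𝓘(ℝ, E) Γ.inv
          (⟨Γ.one (Γ.src g), (X.toFun (Γ.src g)).1⟩ : TangentBundle 𝓘(ℝ, E) G),
          (⟨g, 0⟩ : TangentBundle 𝓘(ℝ, E) G))) :=
    contMDiff_equivTangentBundleProd_symm.comp
      (s₂.prodMk (Bundle.contMDiff_zeroSection ℝ (TangentSpace 𝓘(ℝ, E) : G → Type _)))
  have s₄ := hf.contMDiffOn_tangentMapWithin (m := ∞) (by simp) hU.uniqueMDiffOn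
  have hU' : IsOpen {g : G | (Γ.inv (Γ.one (Γ.src g)), g) ∈ U} :=
    hU.preimage ((Γ.contMDiff_inv.continuous.comp (Γ.contMDiff_one.continuous.comp
      Γ.contMDiff_src.continuous)).prodMk continuous_id)
  have s₅ := s₄.comp (s := {g : G | (Γ.inv (Γ.one (Γ.src g)), g) ∈ U}) s₃.contMDiffOn
    (fun g hg => hg)
  refine ContMDiffOn.contMDiffAt (s₅.congr fun g hg => ?_) (hU'.mem_nhds hgU)
  have hg' : f (Γ.inv (Γ.one (Γ.src g)), g) = g := by
    rw [hfm _ _ ((Γ.tgt_inv _ (Γ.mem _)).trans (Γ.src_one _)) hg, Γ.inv_one, Γ.one_mul _ (Γ.mem _)]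
  refine (TangentBundle.mk_eq_mk_iff hg'.symm).2 ?_
  have e := mfderivWithin_of_isOpen (I := 𝓘(ℝ, E).prod 𝓘(ℝ, E)) (I' := 𝓘(ℝ, E)) (f := f) hU hg
  exact (mfderivWithin_apply_of_mem_tangentSubspace
    (Γ.hasMFDerivWithinAt_inv_mul_right hU hf hfm hg) (X.toFun (Γ.src g)).2).trans
    (DFunLike.congr_fun e.symm _)

theorem ProlongationSection.mem_algebroidFibre [FiniteDimensional ℝ E] [FiniteDimensional ℝ F]
    {Γ : LieGroupoid E F G Q} (Z : Γ.ProlongationSection) (g : G) :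
    (show TangentSpace (𝓘(ℝ, E).prod (𝓘(ℝ, E).prod 𝓘(ℝ, E))) (Γ.prolongation.one g)
      from ((0 : E), (Z.X.toFun (Γ.src g)).1, Z.Y g)) ∈
      Γ.prolongation.algebroidFibre (𝓘(ℝ, E).prod (𝓘(ℝ, E).prod 𝓘(ℝ, E))) g :=
  Γ.mem_prolongation_algebroidFibre_iff.2 ⟨rfl,
    Γ.srcDeriv_eq_zero_of_mem (Z.X.toFun (Γ.src g)).2 (Γ.src_one _),
    (TangentBundle.mk_eq_mk_iff (Γ.tgt_one _)).1 (Z.compat g)⟩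

/-- Every element of the Lie algebroid of the prolongation extends to a smooth section. -/
theorem exists_prolongationSection [FiniteDimensional ℝ E] [FiniteDimensional ℝ F]
    [T2Space G] [IsManifold 𝓘(ℝ, F) ∞ Q] {g : G} {u v w : E}
    (hz : (show TangentSpace (𝓘(ℝ, E).prod (𝓘(ℝ, E).prod 𝓘(ℝ, E))) (Γ.prolongation.one g)
      from (u, v, w)) ∈
      Γ.prolongation.algebroidFibre (𝓘(ℝ, E).prod (𝓘(ℝ, E).prod 𝓘(ℝ, E))) g) :
    ∃ Z : Γ.ProlongationSection, (Z.X.toFun (Γ.src g)).1 = v ∧ Z.Y g = w := by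
  obtain ⟨-, hv, hvw⟩ := Γ.mem_prolongation_algebroidFibre_iff.1 hz
  obtain ⟨V, hV, hVv, hV0⟩ := exists_vertical_field Γ.contMDiff_src (Γ.one (Γ.src g))
    (Γ.submersion_src _) hv
  let X : Γ.AlgebroidSection :=
    { toFun := fun q => ⟨V (Γ.one q), Γ.mem_tangentSubspace_srcFibre (Γ.src_one q) (hV0 _)⟩
      contMDiff := hV.comp Γ.contMDiff_one }
  -- The transported field and the desired value `w` have the same source projection at `g`, so
  -- their difference is vertical and extends to a vertical field `W`. Adding `W` corrects the value
  -- without disturbing compatibility.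
  have hw : Γ.srcDeriv g (w - Γ.rightDeriv g v) = 0 := by
    rw [map_sub, Γ.srcDeriv_rightDeriv (Γ.mem_tangentSubspace_srcFibre (Γ.src_one _) hv), hvw,
      sub_self]
  obtain ⟨(W : G → E), hW, hWw, hW0⟩ := exists_vertical_field Γ.contMDiff_src g (Γ.submersion_src _) hw
  refine ⟨⟨X, fun x => (Γ.rightDeriv x (show E from (X.toFun (Γ.src x)).1) : E) + W x,
    X.contMDiff_rightDeriv.add_section hW, fun x => ?_⟩, hVv, ?_⟩
  · refine (TangentBundle.mk_eq_mk_iff (Γ.tgt_one _)).2 ?_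
    have h := Γ.srcDeriv_rightDeriv (X.toFun (Γ.src x)).2
    have h' : Γ.srcDeriv x (W x) = 0 := hW0 x
    change Γ.tgtDeriv _ _ = Γ.srcDeriv x (_ + _)
    rw [map_add]
    exact h.symm.trans (by rw [h']; exact (add_zero _).symm)
  · have h : W g = w - Γ.rightDeriv g v := hWw
    change Γ.rightDeriv g (V (Γ.one (Γ.src g))) + W g = w
    rw [hVv, h]
    exact add_sub_cancel _ _

end Smooth

end LieGroupoid

/-! ### Components of covectors and the pull-back condition -/

namespace LieGroupoid

variable {E F : Type*} [NormedAddCommGroup E] [NormedSpace ℝ E]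
  [NormedAddCommGroup F] [NormedSpace ℝ F]
  {G Q : Type*} [TopologicalSpace G] [ChartedSpace E G]
  [TopologicalSpace Q] [ChartedSpace F Q]
  (Γ : LieGroupoid E F G Q)

theorem covectorOfComponents_apply {g h r : G} (μ : TangentSpace 𝓘(ℝ, E) g →L[ℝ] ℝ)
    (μ' : TangentSpace 𝓘(ℝ, E) h →L[ℝ] ℝ) (μ'' : TangentSpace 𝓘(ℝ, E) r →L[ℝ] ℝ)
    (z : tangentSubspace (𝓘(ℝ, E).prod (𝓘(ℝ, E).prod 𝓘(ℝ, E))) Γ.prolongation.arrows (g, h, r)) :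
    Γ.covectorOfComponents μ μ' μ'' z =
      μ (z.1 : E × E × E).1 + (μ' (z.1 : E × E × E).2.1 + μ'' (z.1 : E × E × E).2.2) :=
  rfl

/-- Every covector of the prolongation has components. -/
theorem exists_components [FiniteDimensional ℝ E] {g h r : G}
    (γ : Γ.ProlongationCovector (g, h, r)) :
    ∃ (μ : TangentSpace 𝓘(ℝ, E) g →L[ℝ] ℝ) (μ' : TangentSpace 𝓘(ℝ, E) h →L[ℝ] ℝ)
      (μ'' : TangentSpace 𝓘(ℝ, E) r →L[ℝ] ℝ), γ = Γ.covectorOfComponents μ μ' μ'' := by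
  obtain ⟨f, hf⟩ := LinearMap.exists_extend
    (p := (tangentSubspace (𝓘(ℝ, E).prod (𝓘(ℝ, E).prod 𝓘(ℝ, E))) Γ.prolongation.arrows (g, h, r) :
      Submodule ℝ (E × E × E))) γ.toLinearMap
  let f' : E × E × E →L[ℝ] ℝ := LinearMap.toContinuousLinearMap f
  refine ⟨f' ∘L ContinuousLinearMap.inl ℝ E (E × E),
    f' ∘L ContinuousLinearMap.inr ℝ E (E × E) ∘L ContinuousLinearMap.inl ℝ E E,
    f' ∘L ContinuousLinearMap.inr ℝ E (E × E) ∘L ContinuousLinearMap.inr ℝ E E, ?_⟩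
  refine ContinuousLinearMap.ext fun z => ?_
  have h : f z.1 = γ z := LinearMap.congr_fun hf z
  rw [covectorOfComponents_apply, ← h]
  obtain ⟨⟨u, v, w⟩, hz⟩ := z
  change f' (u, v, w) = f' (u, 0, 0) + (f' (0, v, 0) + f' (0, 0, w))
  rw [← map_add, ← map_add]
  simp

/-- The extension by zero used in `differentialOn` agrees with the smooth extension `f` on
composable pairs near `(g, h)`. Hence every choice of `f` gives the same value on tangent vectors.
-/
theorem differentialOn_apply {L : Γ.composable → ℝ} {g h : G}
    (hgh : Γ.tgt g = Γ.src h) {D₁ : TangentSpace 𝓘(ℝ, E) g →L[ℝ] ℝ}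
    {D₂ : TangentSpace 𝓘(ℝ, E) h →L[ℝ] ℝ} (hD : Γ.IsPartialDifferentials L g h D₁ D₂)
    (v : tangentSubspace (𝓘(ℝ, E).prod 𝓘(ℝ, E)) Γ.composable (g, h)) :
    differentialOn (𝓘(ℝ, E).prod 𝓘(ℝ, E)) L (g, h) v =
      D₁ (v.1 : E × E).1 + D₂ (v.1 : E × E).2 := by
  obtain ⟨U, hU, hgU, f, hf, hfL, rfl, rfl⟩ := hD
  have hfd : MDifferentiableAt (𝓘(ℝ, E).prod 𝓘(ℝ, E)) 𝓘(ℝ, ℝ) f (g, h) :=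
    (hf.contMDiffAt (hU.mem_nhds hgU)).mdifferentiableAt (by simp)
  have hext : ∀ c ∈ Γ.composable, c ∈ U → Function.extend Subtype.val L 0 c = f c := by
    intro c hc hcU
    exact (Subtype.val_injective.extend_apply L 0 ⟨c, hc⟩).trans (hfL ⟨c, hc⟩ hcU).symm
  have h₁ : HasMFDerivWithinAt (𝓘(ℝ, E).prod 𝓘(ℝ, E)) 𝓘(ℝ, ℝ) (Function.extend Subtype.val L 0)
      Γ.composable (g, h) (mfderiv (𝓘(ℝ, E).prod 𝓘(ℝ, E)) 𝓘(ℝ, ℝ) f (g, h)) := by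
    refine hfd.hasMFDerivAt.hasMFDerivWithinAt.congr_of_eventuallyEq ?_
      (hext _ ⟨Γ.mem _, Γ.mem _, hgh⟩ hgU)
    filter_upwards [self_mem_nhdsWithin, nhdsWithin_le_nhds (hU.mem_nhds hgU)] with c hc hcU
    exact hext c hc hcU
  exact (mfderivWithin_apply_of_mem_tangentSubspace h₁ v.2).trans (mfderiv_prod_eq_add_apply hfd)

theorem tangentMapOn_inclusion_apply {g h : G}
    (v : tangentSubspace (𝓘(ℝ, E).prod 𝓘(ℝ, E)) Γ.composable (g, h)) :
    ((tangentMapOn (𝓘(ℝ, E).prod 𝓘(ℝ, E)) (𝓘(ℝ, E).prod (𝓘(ℝ, E).prod 𝓘(ℝ, E)))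
      inclusion Γ.mapsTo_inclusion (g, h) (g, g, h) rfl v).1 : E × E × E) =
      ((v.1 : E × E).1, (v.1 : E × E).1, (v.1 : E × E).2) := by
  have h₁ : HasMFDerivAt (𝓘(ℝ, E).prod 𝓘(ℝ, E)) (𝓘(ℝ, E).prod (𝓘(ℝ, E).prod 𝓘(ℝ, E)))
      (inclusion : G × G → G × G × G) (g, h)
      ((ContinuousLinearMap.fst ℝ E E).prod
        ((ContinuousLinearMap.fst ℝ E E).prod (ContinuousLinearMap.snd ℝ E E))) :=
    (hasMFDerivAt_fst (g, h)).prodMk ((hasMFDerivAt_fst (g, h)).prodMk (hasMFDerivAt_snd (g, h)))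
  exact mfderivWithin_apply_of_mem_tangentSubspace h₁.hasMFDerivWithinAt v.2

/-- Membership in `Σ_L` in terms of components. -/
theorem mem_generated_iff {L : Γ.composable → ℝ} {g h : G} (hgh : Γ.tgt g = Γ.src h)
    {D₁ : TangentSpace 𝓘(ℝ, E) g →L[ℝ] ℝ}
    {D₂ : TangentSpace 𝓘(ℝ, E) h →L[ℝ] ℝ} (hD : Γ.IsPartialDifferentials L g h D₁ D₂)
    (μ μ' : TangentSpace 𝓘(ℝ, E) g →L[ℝ] ℝ) (μ'' : TangentSpace 𝓘(ℝ, E) h →L[ℝ] ℝ) :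
    (⟨⟨(g, g, h), rfl, hgh⟩, Γ.covectorOfComponents μ μ' μ''⟩ : Γ.ProlongationCotangent) ∈
        Γ.generated L ↔
      ∀ v ∈ tangentSubspace (𝓘(ℝ, E).prod 𝓘(ℝ, E)) Γ.composable (g, h),
        (μ + μ') v.1 + μ'' v.2 = D₁ v.1 + D₂ v.2 := by
  have key : ∀ v : tangentSubspace (𝓘(ℝ, E).prod 𝓘(ℝ, E)) Γ.composable (g, h),
      Γ.covectorOfComponents μ μ' μ'' (tangentMapOn (𝓘(ℝ, E).prod 𝓘(ℝ, E))
        (𝓘(ℝ, E).prod (𝓘(ℝ, E).prod 𝓘(ℝ, E))) inclusion Γ.mapsTo_inclusion (g, h) (g, g, h) rfl v) =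
      (μ + μ') (v.1 : E × E).1 + μ'' (v.1 : E × E).2 := by
    intro v
    rw [covectorOfComponents_apply, tangentMapOn_inclusion_apply, ← add_assoc]
    rfl
  constructor
  · rintro ⟨⟨⟨a, b⟩, hab⟩, hc, he⟩ v hv
    obtain ⟨rfl, -, rfl⟩ : a = g ∧ a = g ∧ b = h := by simpa [inclusion] using hc
    have := DFunLike.congr_fun he ⟨v, hv⟩
    rw [Γ.differentialOn_apply hgh hD] at this
    exact (key ⟨v, hv⟩).symm.trans this
  · intro hv
    refine ⟨⟨(g, h), Γ.mem _, Γ.mem _, hgh⟩, rfl, ContinuousLinearMap.ext fun v => ?_⟩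
    rw [Γ.differentialOn_apply hgh hD]
    exact (key v).trans (hv v.1 v.2)

/-- A covector of the prolongation that pulls back to `D₁ + D₂` on the composable pairs has
components with the partial differentials `D₁` and `D₂`. -/
theorem exists_components_of_pullback_eq [FiniteDimensional ℝ E] [FiniteDimensional ℝ F]
    [IsManifold 𝓘(ℝ, E) ∞ G] {g h : G} (hgh : Γ.tgt g = Γ.src h)
    {D₁ : TangentSpace 𝓘(ℝ, E) g →L[ℝ] ℝ} {D₂ : TangentSpace 𝓘(ℝ, E) h →L[ℝ] ℝ}
    {μ μ' : TangentSpace 𝓘(ℝ, E) g →L[ℝ] ℝ} {μ'' : TangentSpace 𝓘(ℝ, E) h →L[ℝ] ℝ}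
    (hv : ∀ v ∈ tangentSubspace (𝓘(ℝ, E).prod 𝓘(ℝ, E)) Γ.composable (g, h),
      (μ + μ') v.1 + μ'' v.2 = D₁ v.1 + D₂ v.2) :
    ∃ (ν ν' : TangentSpace 𝓘(ℝ, E) g →L[ℝ] ℝ) (ν'' : TangentSpace 𝓘(ℝ, E) h →L[ℝ] ℝ),
      (Γ.covectorOfComponents μ μ' μ'' : Γ.ProlongationCovector (g, g, h)) =
        Γ.covectorOfComponents ν ν' ν'' ∧ ν + ν' = D₁ ∧ ν'' = D₂ := by
  obtain ⟨R, hR'⟩ := (Γ.srcDeriv h).exists_rightInverse_of_surjective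
    (LinearMap.range_eq_top.2 (Γ.srcDeriv_surjective h))
  have hR : ∀ y, Γ.srcDeriv h (R y) = y := fun y => DFunLike.congr_fun hR' y
  let m : E →L[ℝ] ℝ := μ
  let m' : E →L[ℝ] ℝ := μ'
  let m'' : E →L[ℝ] ℝ := μ''
  let δ₁ : E →L[ℝ] ℝ := D₁
  let δ₂ : E →L[ℝ] ℝ := D₂
  have hvE : ∀ u w : E, Γ.tgtDeriv g u = Γ.srcDeriv h w → m u + m' u + m'' w = δ₁ u + δ₂ w :=
    fun u w huw => hv _ (Γ.mem_tangentSubspace_composable hgh huw)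
  -- The vector `w - R (Tα w)` is in `ker Tα`, so paired with `0` it is tangent to the composable
  -- pairs. The hypothesis there shows that `m'' - δ₂` factors through `Tα`.
  have hd : ∀ w, (m'' - δ₂) (R (Γ.srcDeriv h w)) = m'' w - δ₂ w := by
    intro w
    have := hvE 0 (w - R (Γ.srcDeriv h w)) (by simp [hR])
    simp only [map_zero, map_sub, zero_add, sub_apply] at this ⊢
    linarith
  -- The excess `m'' - δ₂` moves from the last slot to the middle one; `Tβ v = Tα w` makes the
  -- change invisible on the prolongation. The sum condition follows by testing on `(u, R (Tβ u))`.
  let ν' : E →L[ℝ] ℝ := m' + (m'' - δ₂) ∘L R ∘L Γ.tgtDeriv g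
  refine ⟨μ, ν', D₂, ?_, ?_, rfl⟩
  · refine ContinuousLinearMap.ext fun z => ?_
    obtain ⟨⟨u, v, w⟩, hz⟩ := z
    have ht := Γ.tgtDeriv_eq_srcDeriv_of_mem hgh hz
    have hdw := hd w
    rw [← ht] at hdw
    change m u + (m' v + m'' w) = m u + ((m' v + (m'' - δ₂) (R (Γ.tgtDeriv g v))) + δ₂ w)
    rw [hdw]
    ring
  · refine ContinuousLinearMap.ext fun u => ?_
    have := hvE u (R (Γ.tgtDeriv g u)) (hR _).symm
    change m u + (m' u + (m'' - δ₂) (R (Γ.tgtDeriv g u))) = δ₁ u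
    rw [sub_apply]
    linarith

/-! ### Composability and the pairing equations -/

section Composable

variable [FiniteDimensional ℝ E] [FiniteDimensional ℝ F]
  [IsManifold 𝓘(ℝ, E) ∞ G] [T2Space G] [IsManifold 𝓘(ℝ, F) ∞ Q]

/-- Composability in the cotangent groupoid of the prolongation in terms of components. -/
theorem cotangentSrc_eq_cotangentTgt_iff {g h r : G} (hgh : Γ.tgt g = Γ.src h)
    (hhr : Γ.tgt h = Γ.src r)
    (μ μ' : TangentSpace 𝓘(ℝ, E) g →L[ℝ] ℝ) (μ'' : TangentSpace 𝓘(ℝ, E) h →L[ℝ] ℝ)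
    (ν ν' : TangentSpace 𝓘(ℝ, E) h →L[ℝ] ℝ) (ν'' : TangentSpace 𝓘(ℝ, E) r →L[ℝ] ℝ) :
    Γ.prolongation.cotangentSrc (𝓘(ℝ, E).prod (𝓘(ℝ, E).prod 𝓘(ℝ, E)))
        ⟨⟨(h, h, r), rfl, hhr⟩, Γ.covectorOfComponents ν ν' ν''⟩ =
      Γ.prolongation.cotangentTgt (𝓘(ℝ, E).prod (𝓘(ℝ, E).prod 𝓘(ℝ, E)))
        ⟨⟨(g, g, h), rfl, hgh⟩, Γ.covectorOfComponents μ μ' μ''⟩ ↔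
    ∀ Z : Γ.ProlongationSection,
      μ' (Z.X.left g) + μ'' (Z.Y h) = ν' (Z.X.right h) - ν (Z.Y h) := by
  have hsrc : ∀ z : Γ.prolongation.algebroidFibre (𝓘(ℝ, E).prod (𝓘(ℝ, E).prod 𝓘(ℝ, E))) h,
      Γ.covectorOfComponents ν ν' ν''
        (Γ.prolongation.rightInvariant (𝓘(ℝ, E).prod (𝓘(ℝ, E).prod 𝓘(ℝ, E))) (h, h, r)
          ⟨rfl, hhr⟩ z) =
      ν' (-(Γ.rightDeriv h (z.1 : E × E × E).2.1)) - ν (z.1 : E × E × E).2.2 := by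
    intro z
    refine (congrArg (fun v : E × E × E => ν v.1 + (ν' v.2.1 + ν'' v.2.2))
      (Γ.prolongation_rightInvariant_apply ⟨rfl, hhr⟩ z)).trans ?_
    change ν (-(z.1 : E × E × E).2.2) + (ν' (-(Γ.rightDeriv h (z.1 : E × E × E).2.1)) +
      ν'' (-(0 : E))) = _
    have e₁ : ν (-(z.1 : E × E × E).2.2) = -ν (z.1 : E × E × E).2.2 := map_neg ν _
    have e₂ : ν'' (-(0 : E)) = 0 := by
      have : -(0 : E) = 0 := neg_zero
      rw [this]; exact map_zero ν''
    rw [e₁, e₂]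
    ring
  have htgt : ∀ z : Γ.prolongation.algebroidFibre (𝓘(ℝ, E).prod (𝓘(ℝ, E).prod 𝓘(ℝ, E))) h,
      Γ.covectorOfComponents μ μ' μ''
        (Γ.prolongation.leftInvariant (𝓘(ℝ, E).prod (𝓘(ℝ, E).prod 𝓘(ℝ, E))) (g, g, h)
          ⟨rfl, hgh⟩ z) =
      μ' (Γ.leftDeriv g (z.1 : E × E × E).2.1) + μ'' (z.1 : E × E × E).2.2 := by
    intro z
    refine (congrArg (fun v : E × E × E => μ v.1 + (μ' v.2.1 + μ'' v.2.2))
      (Γ.prolongation_leftInvariant_apply ⟨rfl, hgh⟩ z)).trans ?_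
    have e₁ : μ (0 : E) = 0 := map_zero μ
    change μ (0 : E) + _ = _
    rw [e₁, zero_add]
  -- The left-invariant field reads `X` at `tgt g`, the algebroid vector of the prolongation at `src
  -- h`. These points are equal only propositionally.
  have hX : ∀ Z : Γ.ProlongationSection,
      ((Z.X.toFun (Γ.tgt g)).1 : E) = (Z.X.toFun (Γ.src h)).1 := by
    intro Z
    rw [hgh]
  have hleft : ∀ Z : Γ.ProlongationSection, (Z.X.left g : E) =
      Γ.leftDeriv g (show E from (Z.X.toFun (Γ.src h)).1) := fun Z =>
    congrArg (Γ.leftDeriv g) (hX Z)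
  constructor
  · intro he Z
    -- Both base points are `h` by definition, so only the fibre components carry information.
    have he' := eq_of_heq (Sigma.mk.inj he).2
    have h₁ := DFunLike.congr_fun he' ⟨_, Z.mem_algebroidFibre h⟩
    have h' := (htgt _).symm.trans (h₁.symm.trans (hsrc _))
    have e := congrArg (fun x : E => μ' x) (hleft Z)
    exact (congrArg (fun x : ℝ => x + μ'' (Z.Y h)) e).trans h'
  · intro hZ
    refine Sigma.ext rfl (heq_of_eq (ContinuousLinearMap.ext fun z => ?_))
    -- Equality of covectors is tested on single vectors, whereas the hypothesis speaks of global
    -- sections.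
    obtain ⟨Z, hZX, hZY⟩ := Γ.exists_prolongationSection (g := h) z.2
    have e := congrArg (fun x : E => μ' x) (hleft Z)
    have h₁ := (congrArg (fun x : ℝ => x + μ'' (Z.Y h)) e).symm.trans (hZ Z)
    refine (hsrc z).trans (Eq.trans ?_ (htgt z).symm)
    rw [← hZX, ← hZY]
    exact h₁.symm

/-- The components are arbitrary here. This gives (b) directly and allows them to be changed in the
proof of (a). -/
theorem secondOrderDynamics_iff {L : Γ.composable → ℝ} {n : ℕ} {g : ℕ → G}
    (hg : ∀ k < n, Γ.tgt (g k) = Γ.src (g (k + 1)))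
    {γ : ∀ k, Γ.ProlongationCovector (g k, g k, g (k + 1))}
    {D₁ : ∀ k, TangentSpace 𝓘(ℝ, E) (g k) →L[ℝ] ℝ}
    {D₂ : ∀ k, TangentSpace 𝓘(ℝ, E) (g (k + 1)) →L[ℝ] ℝ}
    (hD : ∀ k < n, Γ.IsPartialDifferentials L (g k) (g (k + 1)) (D₁ k) (D₂ k))
    {μ μ' : ∀ k, TangentSpace 𝓘(ℝ, E) (g k) →L[ℝ] ℝ}
    {μ'' : ∀ k, TangentSpace 𝓘(ℝ, E) (g (k + 1)) →L[ℝ] ℝ}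
    (hγ : ∀ k < n, γ k = Γ.covectorOfComponents (μ k) (μ' k) (μ'' k)) :
    Γ.SecondOrderDynamics L (Γ.covectorSequence g hg γ) ↔
      Γ.PairingEquations n g μ μ' μ'' ∧
      ∀ k < n, ∀ v ∈ tangentSubspace (𝓘(ℝ, E).prod 𝓘(ℝ, E)) Γ.composable (g k, g (k + 1)),
        (μ k + μ' k) v.1 + μ'' k v.2 = D₁ k v.1 + D₂ k v.2 := by
  have hc : ∀ (k : ℕ) (hk : k < n), Γ.covectorSequence g hg γ ⟨k, hk⟩ =
      ⟨⟨(g k, g k, g (k + 1)), rfl, hg k hk⟩, Γ.covectorOfComponents (μ k) (μ' k) (μ'' k)⟩ :=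
    fun k hk => by rw [← hγ k hk]; rfl
  rw [SecondOrderDynamics, and_comm]
  refine and_congr ⟨fun h Z k hk => ?_, fun h k hk => ?_⟩
    ⟨fun h k hk => ?_, fun h k => ?_⟩
  · have := h k hk
    rw [hc, hc] at this
    exact (Γ.cotangentSrc_eq_cotangentTgt_iff (hg k (Nat.lt_of_succ_lt hk)) (hg (k + 1) hk)
      _ _ _ _ _ _).1 this Z
  · rw [hc, hc]
    exact (Γ.cotangentSrc_eq_cotangentTgt_iff (hg k (Nat.lt_of_succ_lt hk)) (hg (k + 1) hk)
      _ _ _ _ _ _).2 fun Z => h Z k hk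
  · have := h ⟨k, hk⟩
    rw [hc] at this
    exact (Γ.mem_generated_iff (hg k hk) (hD k hk) _ _ _).1 this
  · rw [show k = ⟨k.1, k.2⟩ from rfl, hc]
    exact (Γ.mem_generated_iff (hg k k.2) (hD k k.2) _ _ _).2 (h k k.2)

end Composable

end LieGroupoid

end

/-- Here `n` counts the covectors, so it plays the role of `N - 1`, and indices start at `0`. -/
theorem mainTheorem2 {E F : Type*} [NormedAddCommGroup E] [NormedSpace ℝ E]
    [FiniteDimensional ℝ E] [NormedAddCommGroup F] [NormedSpace ℝ F] [FiniteDimensional ℝ F]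
    {G Q : Type*} [TopologicalSpace G] [T2Space G] [ChartedSpace E G] [IsManifold 𝓘(ℝ, E) ∞ G]
    [TopologicalSpace Q] [T2Space Q] [ChartedSpace F Q] [IsManifold 𝓘(ℝ, F) ∞ Q]
    (Γ : LieGroupoid E F G Q) (L : Γ.composable → ℝ)
    (hL : SmoothOnSubset (𝓘(ℝ, E).prod 𝓘(ℝ, E)) 𝓘(ℝ, ℝ) Γ.composable L)
    (n : ℕ) (g : ℕ → G) (hg : ∀ k < n, Γ.tgt (g k) = Γ.src (g (k + 1)))
    (γ : ∀ k, Γ.ProlongationCovector (g k, g k, g (k + 1)))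
    (D₁ : ∀ k, TangentSpace 𝓘(ℝ, E) (g k) →L[ℝ] ℝ)
    (D₂ : ∀ k, TangentSpace 𝓘(ℝ, E) (g (k + 1)) →L[ℝ] ℝ)
    (hD : ∀ k < n, Γ.IsPartialDifferentials L (g k) (g (k + 1)) (D₁ k) (D₂ k)) :
    (Γ.SecondOrderDynamics L (Γ.covectorSequence g hg γ) ↔
      ∃ (μ μ' : ∀ k, TangentSpace 𝓘(ℝ, E) (g k) →L[ℝ] ℝ)
        (μ'' : ∀ k, TangentSpace 𝓘(ℝ, E) (g (k + 1)) →L[ℝ] ℝ),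
        (∀ k < n, γ k = Γ.covectorOfComponents (μ k) (μ' k) (μ'' k)) ∧
        Γ.PairingEquations n g μ μ' μ'' ∧
        ∀ k < n, μ k + μ' k = D₁ k ∧ μ'' k = D₂ k) ∧
    (∀ (μ μ' : ∀ k, TangentSpace 𝓘(ℝ, E) (g k) →L[ℝ] ℝ)
        (μ'' : ∀ k, TangentSpace 𝓘(ℝ, E) (g (k + 1)) →L[ℝ] ℝ),
        (∀ k < n, γ k = Γ.covectorOfComponents (μ k) (μ' k) (μ'' k)) →
        (Γ.SecondOrderDynamics L (Γ.covectorSequence g hg γ) ↔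
          Γ.PairingEquations n g μ μ' μ'' ∧
          ∀ k < n, ∀ v ∈ tangentSubspace (𝓘(ℝ, E).prod 𝓘(ℝ, E)) Γ.composable (g k, g (k + 1)),
            (μ k + μ' k) v.1 + μ'' k v.2 = D₁ k v.1 + D₂ k v.2)) := by
  refine ⟨⟨fun h => ?_, ?_⟩, fun μ μ' μ'' hγ => Γ.secondOrderDynamics_iff hg hD hγ⟩
  · have hex : ∀ k, ∃ (μ μ' : TangentSpace 𝓘(ℝ, E) (g k) →L[ℝ] ℝ)
        (μ'' : TangentSpace 𝓘(ℝ, E) (g (k + 1)) →L[ℝ] ℝ), k < n →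
        γ k = Γ.covectorOfComponents μ μ' μ'' ∧ μ + μ' = D₁ k ∧ μ'' = D₂ k := by
      -- Preliminary components serve only to express the pull-back condition; they are then
      -- replaced by ones with the prescribed partial differentials.
      choose μ μ' μ'' hγ using fun k => Γ.exists_components (γ k)
      have h2 := ((Γ.secondOrderDynamics_iff hg hD fun k _ => hγ k).1 h).2
      intro k
      by_cases hk : k < n
      · obtain ⟨ν, ν', ν'', hν, hν₁, hν₂⟩ :=
          Γ.exists_components_of_pullback_eq (hg k hk) (h2 k hk)
        exact ⟨ν, ν', ν'', fun _ => ⟨(hγ k).trans hν, hν₁, hν₂⟩⟩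
      -- The families are indexed by all of `ℕ`; beyond `n` nothing is required.
      · exact ⟨0, 0, 0, fun hk' => absurd hk' hk⟩
    choose μ μ' μ'' hμ using hex
    have hγ : ∀ k < n, γ k = Γ.covectorOfComponents (μ k) (μ' k) (μ'' k) := fun k hk => (hμ k hk).1
    -- The dynamics does not depend on the components, so (1) also holds for the adjusted ones.
    exact ⟨μ, μ', μ'', hγ, ((Γ.secondOrderDynamics_iff hg hD hγ).1 h).1, fun k hk => (hμ k hk).2⟩
  · rintro ⟨μ, μ', μ'', hγ, hpair, hpart⟩
    refine (Γ.secondOrderDynamics_iff hg hD hγ).2 ⟨hpair, fun k hk v _ => ?_⟩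
    rw [(hpart k hk).1, (hpart k hk).2]
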